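/- Let $n\ge 1$ and let $\mathfrak g=\mathfrak{sl}(n+1,\mathbb C)\ltimes\mathbb C^{n+1}$ be the semidirect sum of $\mathfrak{sl}(n+1,\mathbb C)$ with its standard representation, $\mathbb C^{n+1}$ being an abelian ideal with standard basis $P_1,\dots,P_{n+1}$. Write $A_{i,j}$ for the matrix units, $H_i=A_{i,i}-A_{i+1,i+1}$ $(1\le i\le n)$, $F_{p,q}=A_{q+1,p}$ $(1\le p\le q\le n)$, let $\omega_1,\dots,\omega_n$ be the fundamental weights ($\omega_i(H_j)=\delta_{ij}$), put $\omega_0=\omega_{n+1}=0$, and write a weight as $\mu=\sum_i\mu_i\omega_i$. A highest weight vector of weight $\mu$ is a non-zero vector $v$ with $H_iv=\mu_iv$ for all $i$ which is annihilated by all $A_{i,j}$ with $i<j$. For a weight $\mu$ and $1\le k\le s\le n$ put $$\mu_{k,s}=-\sum_{t=k}^{s}(\mu_t+1),$$ and for $1\le i\le n+1$ define elements $Q^{(\mu(i-1))}_k$ $(1\le k\le i)$ of the universal enveloping algebra $\mathcal U(\mathfrak{sl}(n+1))$ recursively by $$Q^{(\mu(i-1))}_i=1,\qquad Q^{(\mu(i-1))}_k=\sum_{l=k}^{i-1}Q^{(\mu(i-1))}_{l+1}\Big(\prod_{m=k+1}^{l}\mu_{m,i-1}\Big)F_{k,l}\quad(1\le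 k<i).$$ If $v$ is zero or a highest weight vector for $\mathfrak{sl}(n+1)$ of weight $\mu$ in a $\mathfrak g$-module, set $$\varphi_i(v)=\sum_{k=1}^{i}\Big(\prod_{m=1}^{k-1}\mu_{m,i-1}\Big)Q^{(\mu(i-1))}_kP_k\,v\qquad(1\le i\le n+1).$$ This vector is again zero or a highest weight vector, of weight $\mu+\omega_i-\omega_{i-1}$, so that the maps $\varphi_i$ can be iterated, each $\varphi_i$ being formed with the weight of the vector it is applied to. Let $V$ be a finite dimensional complex $\mathfrak g$-module, and let $v_{\mu_0}\in V$ be a highest weight vector for $\mathfrak{sl}(n+1)$ of weight $\mu_0$ which generates $V$, that is, $V=\mathcal U(\mathfrak g)v_{\mu_0}$. Then $V$ is the (internal) direct sum $$V=\bigoplus_{(k_1,\dots,k_{n+1})\in\mathbb N^{n+1}}\mathcal U(\mathfrak{sl}(n+1))\,\varphi_{n+1}^{k_{n+1}}\big(\varphi_n^{k_n}\big(\cdots\varphi_1^{k_1}(v_{\mu_0})\cdots\big)\big),$$ where $\mathbb N=\{0,1,2,\dots\}$ and a summand is the zero submodule whenever the iterated vector is zero. -/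

import Mathlib

open LieAlgebra

/- An associative algebra is a Lie algebra under the commutator. -/
attribute [local instance 100] LieRing.ofAssociativeRing

noncomputable section

namespace SlStd

/-! Indices are zero based: rows and columns of `(n+1) × (n+1)` matrices, and the basis vectors
of `ℂ^{n+1}`, are indexed by `Fin (n + 1)`; the simple coroots are indexed by `Fin n`. -/

/-- The Lie algebra `sl(n+1)` of traceless complex matrices of size `n+1`. -/
abbrev Sl (n : ℕ) : LieSubalgebra ℂ (Matrix (Fin (n + 1)) (Fin (n + 1)) ℂ) :=
  SpecialLinear.sl (Fin (n + 1)) ℂ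

/-- The space `ℂ^{n+1}`, viewed below as an abelian Lie algebra. -/
def Std (n : ℕ) : Type := Fin (n + 1) → ℂ

instance (n : ℕ) : AddCommGroup (Std n) := inferInstanceAs (AddCommGroup (Fin (n + 1) → ℂ))

instance (n : ℕ) : Module ℂ (Std n) := inferInstanceAs (Module ℂ (Fin (n + 1) → ℂ))

/-- The bracket on `ℂ^{n+1}` is zero. -/
instance (n : ℕ) : LieRing (Std n) where
  bracket _ _ := 0
  add_lie _ _ _ := (add_zero _).symm
  lie_add _ _ _ := (add_zero _).symm
  lie_self _ := rfl
  leibniz_lie _ _ _ := (add_zero _).symm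

instance (n : ℕ) : LieAlgebra ℂ (Std n) where
  lie_smul _ _ _ := (smul_zero _).symm

/-- The elements of `ℂ^{n+1}` as coordinate vectors. -/
def coords (n : ℕ) : Std n ≃ₗ[ℂ] (Fin (n + 1) → ℂ) := LinearEquiv.refl ℂ (Fin (n + 1) → ℂ)

/-- The standard representation: `sl(n+1)` acts on `ℂ^{n+1}` by matrix times vector. Every linear
endomorphism of an abelian Lie algebra is a derivation. -/
def stdAction (n : ℕ) : Sl n →ₗ⁅ℂ⁆ LieDerivation ℂ (Std n) (Std n) where
  toFun X :=
    { toLinearMap :=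
        (coords n).symm.toLinearMap ∘ₗ Matrix.mulVecLin X.1 ∘ₗ (coords n).toLinearMap
      leibniz' := fun a b => by
        have h : ∀ x y : Std n, ⁅x, y⁆ = 0 := fun _ _ => rfl
        rw [h, h, h, map_zero, sub_zero] }
  map_add' X Y := by
    ext v : 1
    exact congrArg (coords n).symm (Matrix.add_mulVec X.1 Y.1 (coords n v))
  map_smul' c X := by
    ext v : 1
    exact congrArg (coords n).symm (Matrix.smul_mulVec c X.1 (coords n v))
  map_lie' := by
    intro X Y
    ext v : 1
    have h : (X.1 * Y.1 - Y.1 * X.1).mulVec (coords n v) =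
        X.1.mulVec (Y.1.mulVec (coords n v)) - Y.1.mulVec (X.1.mulVec (coords n v)) := by
      rw [Matrix.sub_mulVec, Matrix.mulVec_mulVec, Matrix.mulVec_mulVec]
    exact congrArg (coords n).symm h

/-- The perfect Lie algebra `sl(n+1) ⋉ ℂ^{n+1}`. -/
abbrev G (n : ℕ) : Type := SemiDirectSum (Std n) (Sl n) (stdAction n)

/-- The inclusion of `sl(n+1)` in `sl(n+1) ⋉ ℂ^{n+1}`. -/
abbrev inclSl (n : ℕ) : Sl n →ₗ⁅ℂ⁆ G n := SemiDirectSum.inr (stdAction n)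

/-- The basis vector `P_i` of the abelian ideal `ℂ^{n+1}`. -/
def P {n : ℕ} (i : Fin (n + 1)) : G n :=
  SemiDirectSum.inl (stdAction n) ((coords n).symm (Pi.single i 1))

/-- The matrix unit `A_{i,j}`, `i ≠ j`, as an element of `sl(n+1)`. -/
def matUnit {n : ℕ} (i j : Fin (n + 1)) (h : i ≠ j) : Sl n :=
  SpecialLinear.single i j h (1 : ℂ)

/-- The simple coroot `H_t = A_{t,t} - A_{t+1,t+1}`. -/
def H {n : ℕ} (t : Fin n) : Sl n :=
  SpecialLinear.singleSubSingle t.castSucc t.succ (1 : ℂ)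

/-- `U(L) v`, the submodule generated by `v`, for a representation `ρ` of the Lie algebra `L`. -/
def generated {L V : Type*} [LieRing L] [LieAlgebra ℂ L] [AddCommGroup V] [Module ℂ V]
    (ρ : L →ₗ⁅ℂ⁆ Module.End ℂ V) (v : V) : Submodule ℂ V :=
  LinearMap.range
    ((LinearMap.applyₗ v).comp (UniversalEnvelopingAlgebra.lift ℂ ρ).toLinearMap)

/-- The action of `sl(n+1) ⋉ ℂ^{n+1}` on its module `V`. -/
def rep (n : ℕ) (V : Type*) [AddCommGroup V] [Module ℂ V] [LieRingModule (G n) V]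
    [LieModule ℂ (G n) V] : G n →ₗ⁅ℂ⁆ Module.End ℂ V :=
  LieModule.toEnd ℂ (G n) V

/-- The action of `sl(n+1)` on `V`, by restriction. -/
def repSl (n : ℕ) (V : Type*) [AddCommGroup V] [Module ℂ V] [LieRingModule (G n) V]
    [LieModule ℂ (G n) V] : Sl n →ₗ⁅ℂ⁆ Module.End ℂ V :=
  (rep n V).comp (inclSl n)

/-- A weight `μ = ∑ μ_t ω_t` of `sl(n+1)`, recorded by its coordinates `μ_t = μ(H_t)` in the basis
of fundamental weights. -/
abbrev Weight (n : ℕ) : Type := Fin n → ℂ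

/-- The fundamental weight `ω_m` for `1 ≤ m ≤ n` (here `m` is one based: `ω_m` is dual to the `m`-th
simple coroot), and `ω_0 = ω_{n+1} = 0`. -/
def fundWeight (n : ℕ) (m : ℕ) : Weight n := fun t => if (t : ℕ) + 1 = m then 1 else 0

/-- `v` is a highest weight vector of weight `μ` for `sl(n+1)`. -/
structure IsHighestWeightVector {n : ℕ} {V : Type*} [AddCommGroup V] [Module ℂ V]
    [LieRingModule (G n) V] [LieModule ℂ (G n) V] (μ : Weight n) (v : V) : Prop where
  ne_zero : v ≠ 0
  weight : ∀ t : Fin n, repSl n V (H t) v = μ t • v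
  raising : ∀ (i j : Fin (n + 1)) (h : i < j), repSl n V (matUnit i j h.ne) v = 0

/-- `-∑_{k ≤ t < i} (μ_t + 1)`. In one-based notation this is
`μ_{k,i-1} = -(μ_k + μ_{k+1} + ⋯ + μ_{i-1} + i - k)`. -/
def mu {n : ℕ} (μ : Weight n) (k i : Fin (n + 1)) : ℂ :=
  -∑ t : Fin n with k ≤ t.castSucc ∧ t.castSucc < i, (μ t + 1)

/-- For `k < l ≤ i`, the element `(∏_{k < m < l} μ_{m,i-1}) A_{l,k}` of `U(sl(n+1))`; in one-based
notation this is `F_{k,l-1}^{(μ(i-1))}`, as `F_{p,q} = A_{q+1,p}`. -/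
def F {n : ℕ} (μ : Weight n) (i k l : Fin (n + 1)) (h : k < l) :
    UniversalEnvelopingAlgebra ℂ (Sl n) :=
  (∏ m : Fin (n + 1) with k < m ∧ m < l, mu μ m i) •
    UniversalEnvelopingAlgebra.ι ℂ (matUnit l k h.ne')

/-- For `k ≤ i`, the element `Q_k^{(μ(i-1))}` of `U(sl(n+1))`, given by `Q_i^{(μ(i-1))} = 1` and
`Q_k^{(μ(i-1))} = ∑_{k < l ≤ i} Q_l^{(μ(i-1))} F_{k,l-1}^{(μ(i-1))}` for `k < i`. -/
def Q {n : ℕ} (μ : Weight n) (i k : Fin (n + 1)) : UniversalEnvelopingAlgebra ℂ (Sl n) :=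
  if i ≤ k then 1
  else ∑ l : {l : Fin (n + 1) // k < l ∧ l ≤ i}, Q μ i l.1 * F μ i k l.1 l.2.1
termination_by n - (k : ℕ)
decreasing_by
  exact Nat.sub_lt_sub_left (lt_of_lt_of_le l.2.1 (Nat.le_of_lt_succ l.1.isLt)) l.2.1

section Phi

variable {n : ℕ} {V : Type*} [AddCommGroup V] [Module ℂ V]
  [LieRingModule (G n) V] [LieModule ℂ (G n) V]

/-- The operator `P_k^{(μ(i))} = (∏_{m < k} μ_{m,i-1}) P_k` on `V`, for `k ≤ i`. -/
def scaledP (μ : Weight n) (i k : Fin (n + 1)) : Module.End ℂ V :=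
  (∏ m : Fin (n + 1) with m < k, mu μ m i) • rep n V (P k)

/-- The operator `φ_i = P_i^{(μ(i))} + ∑_{k < i} Q_k^{(μ(i-1))} P_k^{(μ(i))}`, which is meant to be
applied to highest weight vectors of weight `μ`. -/
def phi (μ : Weight n) (i : Fin (n + 1)) : Module.End ℂ V :=
  scaledP μ i i +
    ∑ k : Fin (n + 1) with k < i,
      UniversalEnvelopingAlgebra.lift ℂ (repSl n V) (Q μ i k) * scaledP μ i k

/-- `v ↦ φ_i(v)`, keeping track of the weight: if `v` has weight `μ`, then `φ_i(v)` has weight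
`μ + ω_i - ω_{i-1}` (one-based notation). -/
def phiStep (i : Fin (n + 1)) (x : Weight n × V) : Weight n × V :=
  (x.1 + fundWeight n ((i : ℕ) + 1) - fundWeight n (i : ℕ), phi x.1 i x.2)

/-- The vector `φ_{n+1}^{k_{n+1}}(φ_n^{k_n}( ⋯ φ_1^{k_1}(v) ⋯ ))` for `v` of weight `μ`; the operator
with the smallest index is applied first, and each `φ_i` is formed with the weight of the vector it
is applied to. -/
def phiIterate (k : Fin (n + 1) → ℕ) (μ : Weight n) (v : V) : V :=
  ((List.finRange (n + 1)).foldl (fun x i => (phiStep i)^[k i] x) (μ, v)).2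

end Phi

end SlStd

end

/-! Matrix units with their trace split off act by operators `e i j` satisfying the gl relations,
and commuting `e i i` past `p k` costs the extra scalar κ = 1/(n+1). On a nonzero highest weight
vector, φ_i is a nonzero multiple of `raiseOp`, i.e. of p_i plus terms q_k p_k with k < i, because
the numbers μ_{m,i-1} are differences of coordinates of χ + ρ and dominance makes them negative
integers.

The φ_i commute on highest weight vectors up to nonzero scalars (`IsStdAction.exists_raiseOp_comm`).
For i < j, both φ_j φ_i x and φ_i φ_j x are nonzero multiples of p_i p_j x modulo the gl-module
`lowerPairs` generated by the p_a p_b x of strictly higher weight. A suitable combination is then a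
highest weight vector inside that module, and the Casimir operator shows it to be zero. So φ_b sends
each iterate to a multiple of the iterate with exponent b raised by one.

The sum is V: φ_a is triangular in the P_k, so each P_a w, for w an iterate, lies in the sl-module
generated by the φ_i(w). The sum is therefore stable under all of 𝔤 and contains the generator.

The sum is direct: complete reducibility is not used. A dependence between the summands gives one
between multiples of iterates of a single weight (`IsGlAction.exists_relation`). Equal weights force
the exponents to differ by constant vectors (r, …, r), so one exponent k₀ is the least, and its
iterate w is a combination of iterates reached from w by further φ's. Hence w lies in the span of
the P_a M, where M = U(𝔤)w. Each P_a is nilpotent, so a Nakayama argument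
(`IsStdAction.eq_bot_of_le_iSup_map`) gives M = 0, contradicting w ≠ 0. -/

namespace SlStd

open Module Polynomial

/-! ### Vectors with no component for a given eigenvalue -/

section OffEigen

variable {V : Type*} [AddCommGroup V] [Module ℂ V]

/-- The vectors annihilated by a polynomial in `T` which does not vanish at `c`. -/
def offEigen (T : End ℂ V) (c : ℂ) : Submodule ℂ V where
  carrier := {y | ∃ f : ℂ[X], f.eval c ≠ 0 ∧ aeval T f y = 0}
  zero_mem' := ⟨1, by simp, by simp⟩
  add_mem' := by
    rintro x y ⟨f, hf, hx⟩ ⟨g, hg, hy⟩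
    refine ⟨f * g, by simp [hf, hg], ?_⟩
    rw [map_add]
    nth_rw 1 [mul_comm f g]
    simp [hx, hy]
  smul_mem' := by
    rintro a x ⟨f, hf, hx⟩
    exact ⟨f, hf, by simp [hx]⟩

theorem eq_zero_of_mem_offEigen {T : End ℂ V} {c : ℂ} {x : V} (hx : x ∈ offEigen T c)
    (h : T x = c • x) : x = 0 := by
  obtain ⟨f, hf, hfx⟩ := hx
  rw [Module.End.aeval_apply_of_mem_apply_eq_smul h] at hfx
  exact (smul_eq_zero.1 hfx).resolve_left hf

/-- Multiplying the annihilating polynomial by X - d keeps it nonzero at c. This lets a triangular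
action of T be treated like a diagonal one. -/
theorem mem_offEigen_of_sub_smul_mem {T : End ℂ V} {c d : ℂ} {y : V} (hcd : d ≠ c)
    (h : T y - d • y ∈ offEigen T c) : y ∈ offEigen T c := by
  obtain ⟨f, hf, hfy⟩ := h
  refine ⟨f * (X - C d), by simp [hf, sub_ne_zero.2 hcd.symm], ?_⟩
  simpa [Module.algebraMap_end_apply] using hfy

theorem mem_offEigen_of_apply_eq {T : End ℂ V} {c d : ℂ} {y : V} (hcd : d ≠ c)
    (h : T y = d • y) : y ∈ offEigen T c :=
  mem_offEigen_of_sub_smul_mem hcd (by rw [h, sub_self]; exact zero_mem _)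

theorem apply_mem_offEigen {T S : End ℂ V} (hTS : Commute S T) {c : ℂ} {y : V}
    (hy : y ∈ offEigen T c) : S y ∈ offEigen T c := by
  obtain ⟨f, hf, hfy⟩ := hy
  refine ⟨f, hf, ?_⟩
  have : Commute S (aeval T f) := by
    rw [Polynomial.aeval_eq_sum_range]
    exact Commute.sum_right _ _ _ fun i _ => (hTS.pow_right i).smul_right _
  rw [← Module.End.mul_apply, ← this.eq, Module.End.mul_apply, hfy, map_zero]

end OffEigen

/-! ### Operators with the gl relations and their highest weight vectors -/

section GlAction

variable {N : ℕ} {V : Type*} [AddCommGroup V] [Module ℂ V]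

/-- The operators `e i j` satisfy the commutation relations of the matrix units. -/
def IsGlAction (e : Fin N → Fin N → End ℂ V) : Prop :=
  ∀ i j k l, e i j * e k l =
    e k l * e i j + (if j = k then e i l else 0) - (if l = i then e k j else 0)

/-- The submodule `W` is invariant under all the operators `e i j`. -/
def IsInvariant (e : Fin N → Fin N → End ℂ V) (W : Submodule ℂ V) : Prop :=
  ∀ i j, ∀ x ∈ W, e i j x ∈ W

/-- The smallest invariant submodule containing `S`. -/
def invClosure (e : Fin N → Fin N → End ℂ V) (S : Set V) : Submodule ℂ V :=
  sInf {W | S ⊆ W ∧ IsInvariant e W}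

variable {e : Fin N → Fin N → End ℂ V}

theorem subset_invClosure (S : Set V) : S ⊆ invClosure e S := fun x hx => by
  exact Submodule.mem_sInf.2 fun W hW => hW.1 hx

theorem isInvariant_invClosure (S : Set V) : IsInvariant e (invClosure e S) := fun i j x hx => by
  exact Submodule.mem_sInf.2 fun W hW => hW.2 i j x (Submodule.mem_sInf.1 hx W hW)

theorem invClosure_le {S : Set V} {W : Submodule ℂ V} (hS : S ⊆ W) (hW : IsInvariant e W) :
    invClosure e S ≤ W := sInf_le ⟨hS, hW⟩

/-- `x` is a vector of weight `χ`. -/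
def IsWeight (e : Fin N → Fin N → End ℂ V) (χ : Fin N → ℂ) (x : V) : Prop :=
  ∀ k, e k k x = χ k • x

/-- `x` is zero or a highest weight vector of weight `χ`. -/
structure IsHW (e : Fin N → Fin N → End ℂ V) (χ : Fin N → ℂ) (x : V) : Prop where
  weight : IsWeight e χ x
  raise : ∀ i j, i < j → e i j x = 0

theorem IsHW.smul {χ : Fin N → ℂ} {x : V} (h : IsHW e χ x) (c : ℂ) : IsHW e χ (c • x) :=
  ⟨fun k => by rw [map_smul, h.weight, smul_comm], fun i j hij => by
    rw [map_smul, h.raise i j hij, smul_zero]⟩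

theorem IsHW.sub {χ : Fin N → ℂ} {x y : V} (hx : IsHW e χ x) (hy : IsHW e χ y) :
    IsHW e χ (x - y) :=
  ⟨fun k => by rw [map_sub, hx.weight, hy.weight, smul_sub], fun i j hij => by
    rw [map_sub, hx.raise i j hij, hy.raise i j hij, sub_zero]⟩

theorem isHW_zero (χ : Fin N → ℂ) : IsHW e χ (0 : V) :=
  ⟨fun k => by simp, fun i j _ => by simp⟩

namespace IsGlAction

variable (he : IsGlAction e)
include he

theorem apply_apply (i j k l : Fin N) (x : V) : e i j (e k l x) =
    e k l (e i j x) + (if j = k then e i l x else 0) - (if l = i then e k j x else 0) := by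
  have := congrArg (fun f : End ℂ V => f x) (he i j k l)
  simp only [Module.End.mul_apply, LinearMap.add_apply, LinearMap.sub_apply] at this
  rw [this]
  split_ifs <;> simp

theorem isWeight_apply {χ : Fin N → ℂ} {x : V} (hx : IsWeight e χ x) (i j : Fin N) :
    IsWeight e (fun k => χ k + (if k = i then 1 else 0) - (if k = j then 1 else 0)) (e i j x) := by
  intro k
  rw [he.apply_apply, hx k, map_smul]
  beta_reduce
  by_cases h : k = j
  · subst h
    split_ifs <;> subst_vars <;> simp [add_smul, sub_smul]
  · simp only [h, Ne.symm h, if_false]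
    split_ifs <;> subst_vars <;> simp [add_smul]

/-- Vectors killed by the simple raising operators are killed by all raising operators. -/
theorem isHW_of_simple {χ : Fin N → ℂ} {x : V} (hx : IsWeight e χ x)
    (h : ∀ i j : Fin N, (j : ℕ) = i + 1 → e i j x = 0) : IsHW e χ x := by
  refine ⟨hx, ?_⟩
  suffices H : ∀ d : ℕ, ∀ i j : Fin N, (j : ℕ) = i + 1 + d → e i j x = 0 from
    fun i j hij => H (j - i - 1) i j (by have : (i : ℕ) < j := hij; omega)
  intro d
  induction d with
  | zero => exact fun i j hij => h i j (by omega)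
  | succ d ih =>
    intro i j hij
    have hi : (i : ℕ) + 1 < N := by have := j.isLt; omega
    have h1 := he.apply_apply i ⟨i + 1, hi⟩ ⟨i + 1, hi⟩ j x
    have h2 : j ≠ i := fun hh => by subst hh; omega
    rw [ih ⟨i + 1, hi⟩ j (by simp; omega), h i ⟨i + 1, hi⟩ rfl] at h1
    simpa [h2] using h1.symm

/-- The difference of two coordinates of a highest weight is a natural number. -/
theorem exists_nat [FiniteDimensional ℂ V] {χ : Fin N → ℂ} {x : V} (hx : IsHW e χ x) (h0 : x ≠ 0)
    {i j : Fin N} (hij : i < j) : ∃ m : ℕ, χ i - χ j = m := by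
  have hne : i ≠ j := hij.ne
  -- An `IsSl2Triple` must have a nonzero middle element; if it vanishes, the difference of the
  -- coordinates is 0 anyway.
  by_cases hz : e i i - e j j = 0
  · refine ⟨0, ?_⟩
    have : (χ i - χ j) • x = 0 := by
      rw [sub_smul, ← hx.weight, ← hx.weight, ← LinearMap.sub_apply, hz, LinearMap.zero_apply]
    simpa using (smul_eq_zero.1 this).resolve_right h0
  · have t : IsSl2Triple (e i i - e j j) (e i j) (e j i) := by
      refine ⟨hz, ?_, ?_, ?_⟩
      · rw [LieRing.of_associative_ring_bracket, he i j j i]; simp; abel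
      · rw [LieRing.of_associative_ring_bracket, sub_mul, mul_sub, he i i i j, he j j i j]
        simp [hne.symm, two_smul]; abel
      · rw [LieRing.of_associative_ring_bracket, sub_mul, mul_sub, he i i j i, he j j j i]
        simp [hne, two_smul]; abel
    have P : t.HasPrimitiveVectorWith x (χ i - χ j) := by
      refine ⟨h0, ?_, ?_⟩
      · change (e i i - e j j) x = _
        rw [LinearMap.sub_apply, hx.weight, hx.weight, sub_smul]
      · exact hx.raise i j hij
    obtain ⟨m, hm⟩ := P.exists_nat
    exact ⟨m, hm⟩

end IsGlAction

/-! ### The Casimir operator -/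

/-- The quadratic Casimir operator. -/
noncomputable def casimir (e : Fin N → Fin N → End ℂ V) : End ℂ V := ∑ i, ∑ j, e i j * e j i

/-- The eigenvalue of the Casimir operator on a highest weight vector. -/
noncomputable def casimirValue (χ : Fin N → ℂ) : ℂ :=
  ∑ k, χ k * χ k + ∑ i, ∑ j, if i < j then χ i - χ j else 0

theorem IsGlAction.commute_casimir (he : IsGlAction e) (i j : Fin N) :
    Commute (e i j) (casimir e) := by
  have key : ∀ k l, e i j * (e k l * e l k) = (e k l * e l k) * e i j
      + (if j = k then e i l * e l k else 0) - (if l = i then e k j * e l k else 0)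
      + (if j = l then e k l * e i k else 0) - (if k = i then e k l * e l j else 0) := by
    intro k l
    rw [← mul_assoc, he i j k l, sub_mul, add_mul, mul_assoc (e k l), he i j l k, mul_sub, mul_add]
    simp only [mul_assoc, mul_ite, ite_mul, mul_zero, zero_mul]
    abel
  rw [commute_iff_eq, casimir, Finset.mul_sum, Finset.sum_mul]
  simp_rw [Finset.mul_sum, Finset.sum_mul, key, Finset.sum_sub_distrib, Finset.sum_add_distrib,
    Finset.sum_sub_distrib, Finset.sum_add_distrib]
  rw [Finset.sum_comm (f := fun k l => if j = k then e i l * e l k else 0),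
    Finset.sum_comm (f := fun k l => if k = i then e k l * e l j else 0)]
  simp

/-- For i < j the product e_ij e_ji is reordered so that the raising operator acts first, which
costs χ_i - χ_j. Keeping the remaining terms explicit allows an induction on vectors that are not
highest weight vectors. -/
theorem IsGlAction.casimir_apply (he : IsGlAction e) {χ : Fin N → ℂ} {x : V}
    (hx : IsWeight e χ x) : casimir e x = casimirValue χ • x +
      (2 : ℂ) • ∑ i, ∑ j, if i < j then e j i (e i j x) else 0 := by
  have key : ∀ i j, (e i j * e j i) x = (if i = j then (χ i * χ i) • x else 0)
      + ((if i < j then e j i (e i j x) else 0) + (if i < j then (χ i - χ j) • x else 0)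
      + (if j < i then e i j (e j i x) else 0)) := by
    intro i j
    rcases lt_trichotomy i j with h | h | h
    · rw [Module.End.mul_apply, he.apply_apply]
      simp [h, h.ne, h.not_gt, hx i, hx j, sub_smul, add_sub_assoc]
    · subst h; simp [hx i, smul_smul]
    · simp [h, h.ne', h.not_gt]
  rw [casimir, LinearMap.sum_apply]
  simp_rw [LinearMap.sum_apply, key, Finset.sum_add_distrib]
  rw [Finset.sum_comm (f := fun i j => if j < i then e i j (e j i x) else 0), casimirValue,
    add_smul, Finset.sum_smul, Finset.sum_smul]
  simp only [Finset.sum_smul, ite_smul, zero_smul, two_smul, Finset.sum_ite_eq, Finset.mem_univ,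
    if_true]
  abel

theorem IsGlAction.casimir_apply_of_isHW (he : IsGlAction e) {χ : Fin N → ℂ} {x : V}
    (hx : IsHW e χ x) : casimir e x = casimirValue χ • x := by
  rw [he.casimir_apply hx.weight, Finset.sum_eq_zero, smul_zero, add_zero]
  intro i _
  refine Finset.sum_eq_zero fun j _ => ?_
  split_ifs with h
  · rw [hx.raise i j h, map_zero]
  · rfl

/-- This is ⟨χ - ψ, χ + ψ + 2ρ⟩, where 2ρ has coordinates N - 1 - 2k for zero-based k. -/
theorem casimirValue_sub (χ ψ : Fin N → ℂ) : casimirValue χ - casimirValue ψ =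
    ∑ k, (χ k - ψ k) * (χ k + ψ k + N - 1 - 2 * (k : ℕ)) := by
  have key : ∀ χ : Fin N → ℂ, (∑ i, ∑ j, if i < j then χ i - χ j else 0) =
      ∑ k, χ k * (N - 1 - 2 * (k : ℕ)) := by
    intro χ
    have h1 : ∀ i j : Fin N, (if i < j then χ i - χ j else 0) =
      (if i < j then χ i else 0) - (if i < j then χ j else 0) := by
      intro i j; split_ifs <;> simp
    simp_rw [h1, Finset.sum_sub_distrib]
    rw [Finset.sum_comm (f := fun i j => if i < j then χ j else 0), ← Finset.sum_sub_distrib]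
    refine Finset.sum_congr rfl fun k _ => ?_
    rw [← Finset.sum_filter, ← Finset.sum_filter, Finset.sum_const, Finset.sum_const]
    have h2 : (Finset.univ.filter fun j => k < j) = Finset.Ioi k := by ext; simp
    have h3 : (Finset.univ.filter fun j => j < k) = Finset.Iio k := by ext; simp
    have hk : ((N - 1 - (k : ℕ) : ℕ) : ℂ) = N - 1 - (k : ℕ) := by
      rw [Nat.sub_sub, Nat.cast_sub (by omega)]; push_cast; ring
    rw [h2, h3, Fin.card_Ioi, Fin.card_Iio, nsmul_eq_mul, nsmul_eq_mul, hk]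
    ring
  simp only [casimirValue, key]
  rw [← Finset.sum_add_distrib, ← Finset.sum_add_distrib, ← Finset.sum_sub_distrib]
  exact Finset.sum_congr rfl fun k _ => by ring

end GlAction

end SlStd

/-! ### Raising operators attached to a weight -/

namespace SlStd

open Module

variable {N : ℕ} {V : Type*} [AddCommGroup V] [Module ℂ V]

/-- Induction downwards from `i`. -/
theorem fin_downward_induction {i : Fin N} {p : Fin N → Prop}
    (h : ∀ k ≤ i, (∀ l, k < l → l ≤ i → p l) → p k) : ∀ k ≤ i, p k := by
  suffices H : ∀ d : ℕ, ∀ k ≤ i, (i : ℕ) - k ≤ d → p k from fun k hk => H _ k hk le_rfl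
  intro d
  induction d with
  | zero =>
    intro k hk hd
    refine h k hk fun l hkl hl => ?_
    exact absurd (hkl.trans_le hl) (by rw [Fin.lt_def]; omega)
  | succ d ih =>
    intro k hk hd
    refine h k hk fun l hkl hl => ih l hl ?_
    rw [Fin.lt_def] at hkl
    omega

/-- The difference of the coordinates `i` and `k` of `χ + ρ`. -/
def shiftedDiff (χ : Fin N → ℂ) (i k : Fin N) : ℂ := (χ i - (i : ℕ)) - (χ k - (k : ℕ))

@[simp] theorem shiftedDiff_self (χ : Fin N → ℂ) (i : Fin N) : shiftedDiff χ i i = 0 := by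
  simp [shiftedDiff]

/-- The coefficients of the operator `∑ k ≤ i, q k * p k` raising the weight `χ` by that of `p i`;
they are the elements `Q_k`, up to scalars. -/
structure IsRaisingFamily (e : Fin N → Fin N → End ℂ V) (χ : Fin N → ℂ) (i : Fin N)
    (q : Fin N → End ℂ V) : Prop where
  top : q i = 1
  ne_zero : ∀ k < i, shiftedDiff χ i k ≠ 0
  recursion : ∀ k < i, shiftedDiff χ i k • q k = ∑ l ∈ Finset.Ioc k i, q l * e l k

namespace IsRaisingFamily

variable {e : Fin N → Fin N → End ℂ V} {χ : Fin N → ℂ} {i : Fin N} {q : Fin N → End ℂ V}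
variable (hq : IsRaisingFamily e χ i q)
include hq

theorem recursion_of_le {k : Fin N} (hk : k ≤ i) :
    shiftedDiff χ i k • q k = ∑ l ∈ Finset.Ioc k i, q l * e l k := by
  rcases hk.eq_or_lt with rfl | hk
  · simp
  · exact hq.recursion k hk

theorem apply_mem {W : Submodule ℂ V} (hW : IsInvariant e W) :
    ∀ k ≤ i, ∀ x ∈ W, q k x ∈ W := by
  refine fin_downward_induction fun k hk ih x hx => ?_
  rcases hk.eq_or_lt with rfl | hk
  · simpa [hq.top] using hx
  · rw [← Submodule.smul_mem_iff _ (hq.ne_zero k hk), ← LinearMap.smul_apply, hq.recursion k hk,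
      LinearMap.sum_apply]
    refine Submodule.sum_mem _ fun l hl => ?_
    rw [Finset.mem_Ioc] at hl
    exact ih l hl.1 hl.2 _ (hW l k x hx)

variable (he : IsGlAction e)
include he

/-- The recursion makes q_k homogeneous of weight ε_i - ε_k. -/
theorem diag_mul (a : Fin N) : ∀ k ≤ i, e a a * q k =
    q k * e a a + ((if a = i then 1 else 0) - (if a = k then 1 else 0) : ℂ) • q k := by
  refine fin_downward_induction fun k hk ih => ?_
  rcases hk.eq_or_lt with rfl | hk
  · simp [hq.top]
  · have h0 := hq.ne_zero k hk
    apply smul_right_injective _ h0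
    beta_reduce
    rw [← mul_smul_comm, smul_add, ← smul_mul_assoc, smul_comm, hq.recursion k hk,
      Finset.mul_sum, Finset.sum_mul, Finset.smul_sum, ← Finset.sum_add_distrib]
    refine Finset.sum_congr rfl fun l hl => ?_
    rw [Finset.mem_Ioc] at hl
    rw [← mul_assoc, ih l hl.1 hl.2, add_mul, mul_assoc, he a a l k, mul_sub, mul_add, mul_assoc,
      smul_mul_assoc]
    by_cases h : a = k
    · subst h
      simp [hl.1.ne, hk.ne, sub_eq_add_neg]
    · simp only [h, Ne.symm h, if_false]
      split_ifs <;> subst_vars <;> simp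

/-- The commutator of a simple raising operator with the coefficient `q k`. -/
theorem simple_mul (s t : Fin N) {k : Fin N} (hk : k ≤ i) :
    shiftedDiff χ i k • (e s t * q k - q k * e s t) =
      ∑ l ∈ Finset.Ioc k i, (e s t * q l - q l * e s t) * e l k
      + (if k < t ∧ t ≤ i then q t * e s k else 0)
      - (if k = s then ∑ l ∈ Finset.Ioc k i, q l * e l t else 0) := by
  have key : ∀ l, e s t * (q l * e l k) - (q l * e l k) * e s t =
      (e s t * q l - q l * e s t) * e l k + (if t = l then q l * e s k else 0)
        - (if k = s then q l * e l t else 0) := by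
    intro l
    have := congrArg (q l * ·) (he s t l k)
    simp only [mul_sub, mul_add, mul_ite, mul_zero] at this
    rw [sub_mul, mul_assoc (q l) (e s t), this]
    simp only [mul_assoc]
    abel
  rw [smul_sub, ← mul_smul_comm, ← smul_mul_assoc, hq.recursion_of_le hk, Finset.mul_sum,
    Finset.sum_mul, ← Finset.sum_sub_distrib]
  simp_rw [key, Finset.sum_sub_distrib, Finset.sum_add_distrib]
  congr 2
  · simp
  · split_ifs <;> simp

/-- The matrix units entering q_k have indices between k and i and row larger than column; under
either alternative none of them fails to commute with e_st. -/
theorem simple_comm_of_lt {s t : Fin N} (hst : (t : ℕ) = s + 1) :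
    ∀ k ≤ i, (s < k ∨ i < t) → e s t * q k - q k * e s t = 0 := by
  refine fin_downward_induction fun k hk ih h => ?_
  rcases hk.eq_or_lt with rfl | hk
  · simp [hq.top]
  · have h0 := hq.ne_zero k hk
    have h1 := hq.simple_mul he s t hk.le
    have h2 : ¬ (k < t ∧ t ≤ i) := by
      rcases h with h | h
      · simp only [Fin.lt_def, Fin.le_def] at *; omega
      · exact fun hh => absurd hh.2 h.not_ge
    have h3 : k ≠ s := by
      rintro rfl
      simp only [Fin.lt_def] at *; omega
    rw [if_neg h2, if_neg h3, Finset.sum_eq_zero] at h1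
    · simpa [h0] using h1
    · intro l hl
      rw [Finset.mem_Ioc] at hl
      rw [ih l hl.1 hl.2 (h.imp_left fun h => h.trans hl.1), zero_mul]

theorem simple_comm_self {s t : Fin N} (hst : (t : ℕ) = s + 1) (ht : t ≤ i) :
    shiftedDiff χ i s • (e s t * q s - q s * e s t) =
      q t * (e s s - e t t - shiftedDiff χ i t • 1) := by
  have hs : s < t := by rw [Fin.lt_def]; omega
  have hI : Finset.Ioc s i = insert t (Finset.Ioc t i) := by
    ext l
    simp only [Finset.mem_insert, Finset.mem_Ioc, Fin.lt_def, Fin.le_def, Fin.ext_iff] at *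
    omega
  rw [hq.simple_mul he s t (hs.le.trans ht), if_pos ⟨hs, ht⟩, if_pos rfl, Finset.sum_eq_zero, hI,
    Finset.sum_insert (by simp), ← hq.recursion_of_le ht]
  · simp only [mul_sub, mul_smul_comm, mul_one]; abel
  · intro l hl
    rw [Finset.mem_Ioc] at hl
    rw [hq.simple_comm_of_lt he hst l hl.2 (.inl hl.1), zero_mul]

/-- The generator D of this left ideal kills every p_k x with k < s, for x of weight χ, since p_k
changes coordinates s and t by the same amount. That is how these commutators drop out of φ_i(x). -/
theorem simple_comm_mem {s t : Fin N} (hst : (t : ℕ) = s + 1) (ht : t ≤ i) :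
    ∀ k ≤ i, k < s → e s t * q k - q k * e s t ∈
      Ideal.span {e s s - e t t - (χ s - χ t) • (1 : End ℂ V)} := by
  set D := e s s - e t t - (χ s - χ t) • (1 : End ℂ V) with hD
  have hst' : s < t := by rw [Fin.lt_def]; omega
  have hsi := hst'.trans_le ht
  refine fin_downward_induction fun k hk ih hks => ?_
  have hki := hks.trans hsi
  have h0 := hq.ne_zero k hki
  suffices H : shiftedDiff χ i k • (e s t * q k - q k * e s t) ∈ Ideal.span {D} by
    have := (Ideal.span {D}).mul_mem_left ((shiftedDiff χ i k)⁻¹ • 1) H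
    rwa [smul_mul_assoc, one_mul, smul_smul, inv_mul_cancel₀ h0, one_smul] at this
  have hDe : ∀ l, k < l → l ≠ s → l ≠ t → D * e l k = e l k * D := by
    intro l hl hls hlt
    rw [hD, sub_mul, sub_mul, mul_sub, mul_sub, he s s l k, he t t l k]
    simp [hls.symm, hlt.symm, hks.ne, (hks.trans hst').ne]
  have hDs : (D + 1) * e s k = e s k * (D + 1 + 1) := by
    rw [hD]
    simp only [add_mul, sub_mul, mul_add, mul_sub]
    rw [he s s s k, he t t s k]
    simp [hst'.ne', hks.ne, (hks.trans hst').ne]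
    abel
  have hs0 := hq.ne_zero s hsi
  have hss := hq.simple_comm_self he hst ht
  rw [hq.simple_mul he s t hk, if_pos ⟨hks.trans hst', ht⟩, if_neg hks.ne, sub_zero,
    ← Finset.add_sum_erase _ _ (Finset.mem_Ioc.2 ⟨hks, hsi.le⟩), add_right_comm]
  refine Ideal.add_mem _ ?_ (Ideal.sum_mem _ fun l hl => ?_)
  -- The summand l = s is paired with the extra term q_t e_sk. Moving D past e_sk shifts it by 1,
  -- and the ρ-shift in `shiftedDiff` is exactly what cancels the constant left over.
  · have : (e s t * q s - q s * e s t) * e s k + q t * e s k =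
        ((shiftedDiff χ i s)⁻¹ • (q t * e s k)) * D := by
      have h2 : e s t * q s - q s * e s t =
          (shiftedDiff χ i s)⁻¹ • (q t * (e s s - e t t - shiftedDiff χ i t • 1)) := by
        rw [← hss, smul_smul, inv_mul_cancel₀ hs0, one_smul]
      have h3 : e s s - e t t - shiftedDiff χ i t • 1 =
          D + 1 - (shiftedDiff χ i s + 2) • (1 : End ℂ V) := by
        have : shiftedDiff χ i s = shiftedDiff χ i t - (χ s - χ t) - 1 := by
          simp only [shiftedDiff, hst]; push_cast; ring
        rw [hD, this]; module
      rw [h2, h3, smul_mul_assoc, mul_assoc, sub_mul, hDs]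
      simp only [mul_add, mul_sub, mul_one, mul_smul_comm, one_mul, smul_mul_assoc, mul_assoc]
      match_scalars <;> field_simp
      ring
    rw [this]
    exact Ideal.mul_mem_left _ _ (Ideal.subset_span rfl)
  · rw [Finset.mem_erase, Finset.mem_Ioc] at hl
    rcases lt_or_gt_of_ne hl.1 with h | h
    · obtain ⟨u, hu⟩ := Ideal.mem_span_singleton'.1 (ih l hl.2.1 hl.2.2 h)
      rw [← hu, mul_assoc, hDe l hl.2.1 hl.1 (h.trans hst').ne, ← mul_assoc]
      exact Ideal.mul_mem_left _ _ (Ideal.subset_span rfl)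
    · rw [hq.simple_comm_of_lt he hst l hl.2.2 (.inl h), zero_mul]
      exact zero_mem _

end IsRaisingFamily

/-- The operators `e i j` and `p k` satisfy the commutation relations of the matrix units and of the
basis vectors of the standard representation, up to the scalar `κ` by which the trace is split
off. -/
structure IsStdAction (e : Fin N → Fin N → End ℂ V) (p : Fin N → End ℂ V) (κ : ℂ) : Prop where
  gl : IsGlAction e
  mul : ∀ i j k, e i j * p k =
    p k * e i j + (if j = k then p i else 0) - (if i = j then κ • p k else 0)
  comm : ∀ a b, p a * p b = p b * p a

/-- The weight `χ` plus that of `p i`. -/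
def addWeight (κ : ℂ) (χ : Fin N → ℂ) (i : Fin N) : Fin N → ℂ :=
  fun k => χ k + (if k = i then 1 else 0) - κ

/-- The operator `∑ k ≤ i, q k * p k`. -/
noncomputable def raiseOp (p q : Fin N → End ℂ V) (i : Fin N) : End ℂ V :=
  ∑ k ∈ Finset.Iic i, q k * p k

namespace IsStdAction

variable {e : Fin N → Fin N → End ℂ V} {p : Fin N → End ℂ V} {κ : ℂ} (hp : IsStdAction e p κ)
include hp

theorem apply_p (i j k : Fin N) (x : V) : e i j (p k x) =
    p k (e i j x) + (if j = k then p i x else 0) - (if i = j then κ • p k x else 0) := by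
  have := congrArg (fun f : End ℂ V => f x) (hp.mul i j k)
  simp only [Module.End.mul_apply, LinearMap.add_apply, LinearMap.sub_apply] at this
  rw [this]
  split_ifs <;> simp

theorem p_p (a b : Fin N) (x : V) : p a (p b x) = p b (p a x) :=
  congrArg (fun f : End ℂ V => f x) (hp.comm a b)

theorem isWeight_p {χ : Fin N → ℂ} {x : V} (hx : IsWeight e χ x) (i : Fin N) :
    IsWeight e (addWeight κ χ i) (p i x) := by
  intro k
  rw [hp.apply_p, hx k, map_smul, addWeight]
  split_ifs <;> subst_vars <;> simp_all [add_smul, sub_smul]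

/-- Simple raising operators suffice. For e_st with t = s + 1 ≤ i, only two contributions survive:
the commutator with q_s, and e_st p_t x = p_s x. They cancel by the choice of the recursion. -/
theorem isHW_raiseOp {χ : Fin N → ℂ} {x : V} (hx : IsHW e χ x) {i : Fin N} {q : Fin N → End ℂ V}
    (hq : IsRaisingFamily e χ i q) : IsHW e (addWeight κ χ i) (raiseOp p q i x) := by
  refine hp.gl.isHW_of_simple (fun a => ?_) fun s t hst => ?_
  · simp only [raiseOp, LinearMap.sum_apply, map_sum, Finset.smul_sum, Module.End.mul_apply]
    refine Finset.sum_congr rfl fun k hk => ?_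
    have := congrArg (fun f : End ℂ V => f (p k x)) (hq.diag_mul hp.gl a k (Finset.mem_Iic.1 hk))
    simp only [Module.End.mul_apply, LinearMap.add_apply, LinearMap.smul_apply] at this
    rw [this, hp.isWeight_p hx.weight k a, map_smul, ← add_smul]
    congr 1
    simp only [addWeight]
    ring
  · have hst' : s < t := by rw [Fin.lt_def]; omega
    have hek : ∀ k, e s t (p k x) = if t = k then p s x else 0 := by
      intro k
      rw [hp.apply_p, hx.raise s t hst', map_zero, zero_add, if_neg hst'.ne, sub_zero]
    have key : e s t (raiseOp p q i x) = ∑ k ∈ Finset.Iic i,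
        (((e s t * q k - q k * e s t) (p k x)) + if t = k then q t (p s x) else 0) := by
      simp only [raiseOp, LinearMap.sum_apply, map_sum, Module.End.mul_apply]
      refine Finset.sum_congr rfl fun k hk => ?_
      rw [LinearMap.sub_apply, Module.End.mul_apply, Module.End.mul_apply, hek k]
      split_ifs with h
      · subst h; abel
      · simp
    rw [key]
    by_cases ht : t ≤ i
    · have hsi := hst'.trans_le ht
      rw [Finset.sum_add_distrib, Finset.sum_ite_eq, if_pos (Finset.mem_Iic.2 ht),
        Finset.sum_eq_single s]
      · apply smul_right_injective _ (hq.ne_zero s hsi)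
        beta_reduce
        rw [smul_add, ← LinearMap.smul_apply, hq.simple_comm_self hp.gl hst ht,
          Module.End.mul_apply, LinearMap.sub_apply, LinearMap.sub_apply,
          hp.isWeight_p hx.weight s s, hp.isWeight_p hx.weight s t, smul_zero, ← (q t).map_smul,
          ← (q t).map_add, LinearMap.smul_apply, Module.End.one_apply, ← sub_smul, ← sub_smul,
          ← add_smul]
        convert map_zero (q t)
        rw [smul_eq_zero]
        left
        simp only [addWeight, shiftedDiff, hst, hst'.ne', if_true, if_false]
        push_cast
        ring
      · intro k hk hks
        rw [Finset.mem_Iic] at hk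
        rcases lt_or_gt_of_ne hks with h | h
        · obtain ⟨u, hu⟩ := Ideal.mem_span_singleton'.1 (hq.simple_comm_mem hp.gl hst ht k hk h)
          rw [← hu, Module.End.mul_apply, LinearMap.sub_apply, LinearMap.sub_apply,
            hp.isWeight_p hx.weight k s, hp.isWeight_p hx.weight k t]
          convert map_zero u
          rw [LinearMap.smul_apply, Module.End.one_apply, ← sub_smul, ← sub_smul, smul_eq_zero]
          left
          simp only [addWeight, h.ne', (h.trans hst').ne', if_false]
          ring
        · rw [hq.simple_comm_of_lt hp.gl hst k hk (.inl h), LinearMap.zero_apply]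
      · intro h; exact absurd (Finset.mem_Iic.2 hsi.le) h
    · refine Finset.sum_eq_zero fun k hk => ?_
      rw [Finset.mem_Iic] at hk
      rw [hq.simple_comm_of_lt hp.gl hst k hk (.inr (not_le.1 ht)), LinearMap.zero_apply, if_neg,
        add_zero]
      rintro rfl
      exact ht hk

end IsStdAction

end SlStd

/-! ### Commutation of the raising operators up to scalars -/

namespace SlStd

open Module

variable {N : ℕ} {V : Type*} [AddCommGroup V] [Module ℂ V]
variable {e : Fin N → Fin N → End ℂ V} {p : Fin N → End ℂ V} {κ : ℂ}

/-- The differences of successive coordinates of `χ` are natural numbers. -/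
def IsDominant (χ : Fin N → ℂ) : Prop := ∀ i j, i < j → ∃ m : ℕ, χ i - χ j = m

theorem IsHW.isDominant [FiniteDimensional ℂ V] (he : IsGlAction e) {χ : Fin N → ℂ} {x : V}
    (hx : IsHW e χ x) (h0 : x ≠ 0) : IsDominant χ := fun _ _ hij => he.exists_nat hx h0 hij

theorem IsDominant.shiftedDiff_eq {χ : Fin N → ℂ} (h : IsDominant χ) {i k : Fin N} (hk : k < i) :
    ∃ m : ℕ, shiftedDiff χ i k = -(m + 1 : ℕ) := by
  obtain ⟨m, hm⟩ := h k i hk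
  have hk' : (k : ℕ) < i := hk
  refine ⟨m + (i - k - 1), ?_⟩
  have : ((i - k - 1 : ℕ) : ℂ) = i - k - 1 := by
    rw [Nat.sub_sub, Nat.cast_sub (by omega)]; push_cast; ring
  rw [shiftedDiff, Nat.cast_add, Nat.cast_add, this, ← hm]
  push_cast
  ring

theorem IsDominant.shiftedDiff_ne_zero {χ : Fin N → ℂ} (h : IsDominant χ) {i k : Fin N}
    (hk : k < i) : shiftedDiff χ i k ≠ 0 := by
  obtain ⟨m, hm⟩ := h.shiftedDiff_eq hk
  rw [hm, neg_ne_zero, Nat.cast_ne_zero]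
  omega

/-- Both weights are reached from χ - 2κ by adding two unit vectors, and each addition changes the
Casimir value by a linear expression. -/
theorem casimirValue_addWeight (κ : ℂ) (χ : Fin N → ℂ) (a b i j : Fin N) :
    casimirValue (addWeight κ (addWeight κ χ a) b) - casimirValue (addWeight κ (addWeight κ χ i) j)
      = -2 * (shiftedDiff χ i a + shiftedDiff χ j b) + 2 * (if a = b then 1 else 0)
        - 2 * (if i = j then 1 else 0) := by
  have h : ∀ (ψ : Fin N → ℂ) (c : Fin N), casimirValue (addWeight κ ψ c) -
      casimirValue (addWeight κ ψ c - Pi.single c 1) =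
        2 * (ψ c - κ) + N - 2 * (c : ℕ) := by
    intro ψ c
    rw [casimirValue_sub, Finset.sum_eq_single c]
    · simp [addWeight]; ring
    · intro b _ hb; simp [hb]
    · simp
  have h1 := h (addWeight κ χ a) b
  have h2 := h (addWeight κ χ i) j
  have h3 := h (fun k => χ k - κ) a
  have h4 := h (fun k => χ k - κ) i
  have e1 : ∀ (ψ : Fin N → ℂ) (c d : Fin N), addWeight κ (addWeight κ ψ c) d - Pi.single d 1 =
      addWeight κ (fun k => ψ k - κ) c := by
    intro ψ c d; ext k; simp [addWeight, Pi.single_apply]; ring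
  have e2 : ∀ c : Fin N, addWeight κ (fun k => χ k - κ) c - Pi.single c 1 = fun k => χ k - κ - κ := by
    intro c; ext k; simp [addWeight, Pi.single_apply]; ring
  rw [e1] at h1 h2
  rw [e2] at h3 h4
  have : casimirValue (addWeight κ (addWeight κ χ a) b) -
      casimirValue (addWeight κ (addWeight κ χ i) j) =
      (2 * (addWeight κ χ a b - κ) + N - 2 * (b : ℕ)) + (2 * (χ a - κ - κ) + N - 2 * (a : ℕ))
      - (2 * (addWeight κ χ i j - κ) + N - 2 * (j : ℕ))
      - (2 * (χ i - κ - κ) + N - 2 * (i : ℕ)) := by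
    linear_combination h1 - h2 + h3 - h4
  rw [this]
  simp only [addWeight, shiftedDiff, eq_comm (a := b), eq_comm (a := j)]
  ring

namespace IsRaisingFamily

variable {χ : Fin N → ℂ} {i : Fin N} {q : Fin N → End ℂ V}

/-- An off-diagonal matrix unit disturbs p_a only if its column is a, and the columns entering q_l
run from l to below i. -/
theorem p_apply (hq : IsRaisingFamily e χ i q) (hp : IsStdAction e p κ) (a : Fin N) :
    ∀ l ≤ i, (a < l ∨ i ≤ a) → ∀ y, p a (q l y) = q l (p a y) := by
  refine fin_downward_induction fun l hl ih ha y => ?_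
  rcases hl.eq_or_lt with rfl | hl
  · simp [hq.top]
  · have h0 := hq.ne_zero l hl
    apply smul_right_injective _ h0
    beta_reduce
    rw [← map_smul, ← LinearMap.smul_apply, ← LinearMap.smul_apply, hq.recursion l hl,
      LinearMap.sum_apply, LinearMap.sum_apply, map_sum]
    refine Finset.sum_congr rfl fun m hm => ?_
    rw [Finset.mem_Ioc] at hm
    have hla : l ≠ a := by
      rintro rfl
      rcases ha with h | h
      · exact lt_irrefl _ h
      · exact absurd hl h.not_gt
    rw [Module.End.mul_apply, Module.End.mul_apply, ih m hm.1 hm.2 (ha.imp_left (·.trans hm.1)),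
      hp.apply_p, if_neg hla, if_neg hm.1.ne', add_zero, sub_zero]

/-- Moving p_a past a factor e_ml of q_l can only replace it by p_m with m ≤ i, and such an m is
again in B. -/
theorem p_apply_mem (hq : IsRaisingFamily e χ i q) (hp : IsStdAction e p κ) {W : Submodule ℂ V}
    (hW : IsInvariant e W) {B : Set (Fin N)} (hB : ∀ b ≤ i, b ∈ B) :
    ∀ l ≤ i, ∀ y, (∀ b ∈ B, p b y ∈ W) → ∀ a ∈ B, p a (q l y) ∈ W := by
  refine fin_downward_induction fun l hl ih y hy a ha => ?_
  rcases hl.eq_or_lt with rfl | hl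
  · simpa [hq.top] using hy a ha
  · rw [← Submodule.smul_mem_iff _ (hq.ne_zero l hl), ← map_smul, ← LinearMap.smul_apply,
      hq.recursion l hl, LinearMap.sum_apply, map_sum]
    refine Submodule.sum_mem _ fun m hm => ?_
    rw [Finset.mem_Ioc] at hm
    refine ih m hm.1 hm.2 _ (fun b hb => ?_) a ha
    have := hp.apply_p m l b y
    rw [if_neg hm.1.ne', sub_zero, ← sub_eq_iff_eq_add] at this
    rw [← this]
    refine W.sub_mem (hW _ _ _ (hy b hb)) ?_
    split_ifs
    · exact hy m (hB m hm.2)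
    · exact W.zero_mem

/-- Only the rightmost factor e_ml of each term of q_l has column l, and it turns p_l into p_m. This
correction produces the scalar in the commutation of two raising operators. -/
theorem p_self_apply (hq : IsRaisingFamily e χ i q) (hp : IsStdAction e p κ) {l : Fin N}
    (hl : l < i) (y : V) : shiftedDiff χ i l • p l (q l y) =
      shiftedDiff χ i l • q l (p l y) - ∑ m ∈ Finset.Ioc l i, q m (p m y) := by
  rw [← map_smul, ← LinearMap.smul_apply, ← LinearMap.smul_apply, hq.recursion l hl,
    LinearMap.sum_apply, LinearMap.sum_apply, map_sum, ← Finset.sum_sub_distrib]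
  refine Finset.sum_congr rfl fun m hm => ?_
  rw [Finset.mem_Ioc] at hm
  rw [Module.End.mul_apply, Module.End.mul_apply, hq.p_apply hp l m hm.2 (.inl hm.1), hp.apply_p,
    if_pos rfl, if_neg hm.1.ne', sub_zero, map_add, add_sub_cancel_right]

end IsRaisingFamily

/-- The invariant submodule generated by the vectors `p a (p b x)` with `a ≤ i`, `b ≤ j` and
`(a, b) ≠ (i, j)`. -/
def lowerPairs (e : Fin N → Fin N → End ℂ V) (p : Fin N → End ℂ V) (i j : Fin N) (x : V) :
    Submodule ℂ V :=
  invClosure e {y | ∃ a b, a ≤ i ∧ b ≤ j ∧ (a < i ∨ b < j) ∧ p a (p b x) = y}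

theorem mem_lowerPairs {i j a b : Fin N} {x : V} (ha : a ≤ i) (hb : b ≤ j) (h : a < i ∨ b < j) :
    p a (p b x) ∈ lowerPairs e p i j x := subset_invClosure _ ⟨a, b, ha, hb, h, rfl⟩

namespace IsStdAction

variable (hp : IsStdAction e p κ)
include hp

/-- Highest weight vectors of the weight of `p i (p j x)` do not occur in `lowerPairs`. -/
theorem eq_zero_of_mem_lowerPairs {χ : Fin N → ℂ} {x : V} (hx : IsHW e χ x) (hχ : IsDominant χ)
    {i j : Fin N} (hij : i < j) {y : V} (hy : IsHW e (addWeight κ (addWeight κ χ i) j) y)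
    (hmem : y ∈ lowerPairs e p i j x) : y = 0 := by
  set c := casimirValue (addWeight κ (addWeight κ χ i) j) with hc
  refine eq_zero_of_mem_offEigen (T := casimir e) (c := c) ?_ (hp.gl.casimir_apply_of_isHW hy)
  have hinv : IsInvariant e (offEigen (casimir e) c) :=
    fun s t z hz => apply_mem_offEigen (hp.gl.commute_casimir s t) hz
  refine invClosure_le ?_ hinv hmem
  suffices H : ∀ d : ℕ, ∀ a b : Fin N, (a : ℕ) + b = d → a ≤ i → b ≤ j → (a < i ∨ b < j) →
      p a (p b x) ∈ offEigen (casimir e) c by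
    rintro _ ⟨a, b, ha, hb, h, rfl⟩
    exact H _ a b rfl ha hb h
  have hne : ∀ a b : Fin N, a ≤ i → b ≤ j → (a < i ∨ b < j) →
      casimirValue (addWeight κ (addWeight κ χ b) a) ≠ c := by
    intro a b ha hb h
    rw [← sub_ne_zero, hc]
    have hcomm : addWeight κ (addWeight κ χ b) a = addWeight κ (addWeight κ χ a) b := by
      ext k; simp only [addWeight]; ring
    rw [hcomm, casimirValue_addWeight, if_neg hij.ne]
    have h1 : ∀ {a i : Fin N}, a ≤ i → ∃ m : ℕ, shiftedDiff χ i a = -(m : ℂ) ∧ (a < i → 0 < m) := by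
      intro a i ha
      rcases ha.eq_or_lt with rfl | ha
      · exact ⟨0, by simp, by simp⟩
      · obtain ⟨m, hm⟩ := hχ.shiftedDiff_eq ha
        exact ⟨m + 1, hm, fun _ => by omega⟩
    obtain ⟨m, hm, hm'⟩ := h1 ha
    obtain ⟨m', hmm, hmm'⟩ := h1 hb
    have hpos : 0 < m + m' := by
      rcases h with h | h
      · have := hm' h; omega
      · have := hmm' h; omega
    rw [hm, hmm]
    -- By dominance the Casimir value strictly exceeds c unless (a, b) = (i, j), so none of these
    -- eigenvalues equals c.
    have : -2 * (-(m : ℂ) + -(m' : ℂ)) + 2 * (if a = b then 1 else 0) - 2 * 0 =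
        ((2 * (m + m') + 2 * (if a = b then 1 else 0) : ℕ) : ℂ) := by
      split_ifs <;> push_cast <;> ring
    rw [this, Nat.cast_ne_zero]
    omega
  -- The Casimir operator is triangular on the p_a p_b x: besides a scalar it gives lowering
  -- operators applied to such vectors with smaller a + b. Strong induction on a + b therefore
  -- applies.
  intro d
  induction d using Nat.strong_induction_on with
  | _ d ih =>
    intro a b hd ha hb h
    refine mem_offEigen_of_sub_smul_mem (hne a b ha hb h) ?_
    rw [hp.gl.casimir_apply (hp.isWeight_p (hp.isWeight_p hx.weight b) a), add_sub_cancel_left]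
    refine Submodule.smul_mem _ _ (Submodule.sum_mem _ fun s _ => Submodule.sum_mem _ fun t _ => ?_)
    split_ifs with hst
    · have hst' : (s : ℕ) < t := hst
      apply hinv
      rw [hp.apply_p, if_neg hst.ne, sub_zero, hp.apply_p, if_neg hst.ne, sub_zero,
        hx.raise s t hst, map_zero, zero_add]
      refine Submodule.add_mem _ ?_ ?_
      · split_ifs with htb
        · subst htb
          exact ih (a + s) (by omega) a s rfl ha (hst.le.trans hb) (.inr (hst.trans_le hb))
        · simp
      · split_ifs with hta
        · subst hta
          exact ih (s + b) (by omega) s b rfl (hst.le.trans ha) hb (.inl (hst.trans_le ha))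
        · simp
    · exact zero_mem _

variable {χ : Fin N → ℂ} {x : V} {i j : Fin N} {q : Fin N → End ℂ V}

/-- Raising by the smaller index first. -/
theorem p_raiseOp_mem (hij : i < j) (hq : IsRaisingFamily e χ i q) {k : Fin N} (hk : k < j) :
    p k (raiseOp p q i x) ∈ lowerPairs e p i j x := by
  rw [raiseOp, LinearMap.sum_apply, map_sum]
  refine Submodule.sum_mem _ fun l hl => ?_
  rw [Finset.mem_Iic] at hl
  refine hq.p_apply_mem hp (isInvariant_invClosure _) (B := Set.Iio j)
    (fun b hb => hb.trans_lt hij) l hl (p l x) (fun b hb => ?_) k hk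
  rw [hp.p_p]
  exact mem_lowerPairs hl (le_of_lt hb) (.inr hb)

/-- Since j > i, p_j commutes with every q_l, so only the top term, with q_i = 1, leaves
`lowerPairs`. -/
theorem p_raiseOp_sub_mem (hij : i < j) (hq : IsRaisingFamily e χ i q) :
    p j (raiseOp p q i x) - p i (p j x) ∈ lowerPairs e p i j x := by
  rw [raiseOp, LinearMap.sum_apply, map_sum, ← Finset.add_sum_erase _ _ (Finset.mem_Iic.2 le_rfl),
    hq.top, one_mul, hp.p_p, add_sub_cancel_left]
  refine Submodule.sum_mem _ fun l hl => ?_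
  rw [Finset.mem_erase, Finset.mem_Iic] at hl
  rw [Module.End.mul_apply, hq.p_apply hp j l hl.2 (.inr hij.le), hp.p_p]
  exact hq.apply_mem (isInvariant_invClosure _) l hl.2 _
    (mem_lowerPairs hl.2 le_rfl (.inl (lt_of_le_of_ne hl.2 hl.1)))

theorem raiseOp_raiseOp_sub_mem (hij : i < j) (hq : IsRaisingFamily e χ i q) {χ' : Fin N → ℂ}
    {q' : Fin N → End ℂ V} (hq' : IsRaisingFamily e χ' j q') :
    raiseOp p q' j (raiseOp p q i x) - p i (p j x) ∈ lowerPairs e p i j x := by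
  nth_rw 1 [raiseOp]
  rw [LinearMap.sum_apply, ← Finset.add_sum_erase _ _ (Finset.mem_Iic.2 le_rfl),
    hq'.top, one_mul, add_sub_right_comm]
  refine Submodule.add_mem _ (hp.p_raiseOp_sub_mem hij hq) (Submodule.sum_mem _ fun k hk => ?_)
  rw [Finset.mem_erase, Finset.mem_Iic] at hk
  exact hq'.apply_mem (isInvariant_invClosure _) k hk.2 _
    (hp.p_raiseOp_mem hij hq (lt_of_le_of_ne hk.2 hk.1))

/-- Raising by the larger index first. -/
theorem p_raiseOp_mem' (hij : i < j) (hq : IsRaisingFamily e χ j q) {k : Fin N} (hk : k < i) :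
    p k (raiseOp p q j x) ∈ lowerPairs e p i j x := by
  rw [raiseOp, LinearMap.sum_apply, map_sum]
  refine Submodule.sum_mem _ fun l hl => ?_
  rw [Finset.mem_Iic] at hl
  rcases lt_or_ge l i with hli | hil
  · refine hq.p_apply_mem hp (isInvariant_invClosure _) (B := Set.Iic j)
      (fun b hb => hb) l hl (p l x) (fun b hb => ?_) k (hk.le.trans hij.le)
    rw [hp.p_p]
    exact mem_lowerPairs hli.le hb (.inl hli)
  · rw [Module.End.mul_apply, hq.p_apply hp k l hl (.inl (hk.trans_le hil))]
    exact hq.apply_mem (isInvariant_invClosure _) l hl _ (mem_lowerPairs hk.le hl (.inl hk))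

/-- Two terms contribute to p_i p_j x: the top one l = j gives 1, and l = i gives minus the inverse
of `shiftedDiff χ j i` through `p_self_apply`. All others are in `lowerPairs`. -/
theorem p_raiseOp_sub_mem' (hij : i < j) (hq : IsRaisingFamily e χ j q) :
    p i (raiseOp p q j x) - (1 - (shiftedDiff χ j i)⁻¹) • p i (p j x) ∈ lowerPairs e p i j x := by
  have h0 := hq.ne_zero i hij
  have hterm : ∀ l ≤ j, i < l → l ≠ j → q l (p l (p i x)) ∈ lowerPairs e p i j x := by
    intro l hl _ hlj
    refine hq.apply_mem (isInvariant_invClosure _) l hl _ ?_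
    rw [hp.p_p]
    exact mem_lowerPairs le_rfl hl (.inr (lt_of_le_of_ne hl hlj))
  have hsum : ∑ m ∈ Finset.Ioc i j, q m (p m (p i x)) - p i (p j x) ∈ lowerPairs e p i j x := by
    rw [← Finset.add_sum_erase _ _ (Finset.mem_Ioc.2 ⟨hij, le_rfl⟩), hq.top, Module.End.one_apply,
      hp.p_p j i, add_sub_cancel_left]
    refine Submodule.sum_mem _ fun l hl => ?_
    rw [Finset.mem_erase, Finset.mem_Ioc] at hl
    exact hterm l hl.2.2 hl.2.1 hl.1
  have hi : p i (q i (p i x)) + (shiftedDiff χ j i)⁻¹ • p i (p j x) ∈ lowerPairs e p i j x := by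
    have h1 := hq.p_self_apply hp hij (p i x)
    have h2 : p i (q i (p i x)) + (shiftedDiff χ j i)⁻¹ • p i (p j x) = q i (p i (p i x)) -
        (shiftedDiff χ j i)⁻¹ • (∑ m ∈ Finset.Ioc i j, q m (p m (p i x)) - p i (p j x)) := by
      apply smul_right_injective _ h0
      beta_reduce
      rw [smul_add, h1, smul_sub, smul_smul, smul_smul, mul_inv_cancel₀ h0, one_smul, one_smul]
      abel
    rw [h2]
    exact Submodule.sub_mem _ (hq.apply_mem (isInvariant_invClosure _) i hij.le _
      (mem_lowerPairs le_rfl hij.le (.inr hij))) (Submodule.smul_mem _ _ hsum)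
  have hmem : i ∈ (Finset.Iic j).erase j := Finset.mem_erase.2 ⟨hij.ne, Finset.mem_Iic.2 hij.le⟩
  have h3 : p i (raiseOp p q j x) - (1 - (shiftedDiff χ j i)⁻¹) • p i (p j x) =
      (p i (q i (p i x)) + (shiftedDiff χ j i)⁻¹ • p i (p j x)) +
        ∑ l ∈ ((Finset.Iic j).erase j).erase i, p i (q l (p l x)) := by
    rw [raiseOp, LinearMap.sum_apply, map_sum,
      ← Finset.add_sum_erase _ _ (Finset.mem_Iic.2 le_rfl), ← Finset.add_sum_erase _ _ hmem,
      hq.top, one_mul, sub_smul, one_smul]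
    simp only [Module.End.mul_apply]
    abel
  rw [h3]
  refine Submodule.add_mem _ hi (Submodule.sum_mem _ fun l hl => ?_)
  rw [Finset.mem_erase, Finset.mem_erase, Finset.mem_Iic] at hl
  rcases lt_or_gt_of_ne hl.1 with hli | hil
  · refine hq.p_apply_mem hp (isInvariant_invClosure _) (B := Set.Iic j)
      (fun b hb => hb) l hl.2.2 (p l x) (fun b hb => ?_) i hij.le
    rw [hp.p_p]
    exact mem_lowerPairs hli.le hb (.inl hli)
  · rw [hq.p_apply hp i l hl.2.2 (.inl hil), hp.p_p]
    exact hterm l hl.2.2 hil hl.2.1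

theorem raiseOp_raiseOp_sub_mem' (hij : i < j) (hq : IsRaisingFamily e χ j q) {χ' : Fin N → ℂ}
    {q' : Fin N → End ℂ V} (hq' : IsRaisingFamily e χ' i q') :
    raiseOp p q' i (raiseOp p q j x) - (1 - (shiftedDiff χ j i)⁻¹) • p i (p j x) ∈
      lowerPairs e p i j x := by
  nth_rw 1 [raiseOp]
  rw [LinearMap.sum_apply, ← Finset.add_sum_erase _ _ (Finset.mem_Iic.2 le_rfl),
    hq'.top, one_mul, add_sub_right_comm]
  refine Submodule.add_mem _ (hp.p_raiseOp_sub_mem' hij hq) (Submodule.sum_mem _ fun k hk => ?_)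
  rw [Finset.mem_erase, Finset.mem_Iic] at hk
  exact hq'.apply_mem (isInvariant_invClosure _) k hk.2 _
    (hp.p_raiseOp_mem' hij hq (lt_of_le_of_ne hk.2 hk.1))

/-- The raising operators commute on highest weight vectors, up to non-zero scalars. -/
theorem exists_raiseOp_comm [FiniteDimensional ℂ V] (hx : IsHW e χ x) (hχ : IsDominant χ)
    (hij : i < j) {qi qj qi' qj' : Fin N → End ℂ V}
    (hqi : IsRaisingFamily e χ i qi) (hqj : IsRaisingFamily e χ j qj)
    (hqi' : raiseOp p qj j x ≠ 0 → IsRaisingFamily e (addWeight κ χ j) i qi')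
    (hqj' : raiseOp p qi i x ≠ 0 → IsRaisingFamily e (addWeight κ χ i) j qj') :
    ∃ c : ℂ, c ≠ 0 ∧
      raiseOp p qi' i (raiseOp p qj j x) = c • raiseOp p qj' j (raiseOp p qi i x) := by
  have hcomm : addWeight κ (addWeight κ χ j) i = addWeight κ (addWeight κ χ i) j := by
    ext k; simp only [addWeight]; ring
  -- The shifted difference is -(m + 1), so the scalar is 1 + 1/(m + 1) > 0.
  have h1 : 1 - (shiftedDiff χ j i)⁻¹ ≠ 0 := by
    obtain ⟨m, hm⟩ := hχ.shiftedDiff_eq hij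
    rw [hm, inv_neg, sub_neg_eq_add]
    have : (0 : ℝ) < 1 + ((m + 1 : ℕ) : ℝ)⁻¹ := by positivity
    intro h
    apply this.ne'
    apply Complex.ofReal_injective
    push_cast at h ⊢
    exact h
  obtain ⟨a, ha, hA⟩ : ∃ a : ℂ, a ≠ 0 ∧ raiseOp p qj' j (raiseOp p qi i x) - a • p i (p j x) ∈
      lowerPairs e p i j x := by
    refine ⟨1, one_ne_zero, ?_⟩
    rw [one_smul]
    -- If the first raised vector vanishes, its would-be weight need not be dominant and no second
    -- family is available; the one-step congruence then suffices.
    by_cases h0 : raiseOp p qi i x = 0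
    · have := hp.p_raiseOp_sub_mem (x := x) hij hqi
      rw [h0, map_zero] at this ⊢
      exact this
    · exact hp.raiseOp_raiseOp_sub_mem hij hqi (hqj' h0)
  obtain ⟨b, hb, hB⟩ : ∃ b : ℂ, b ≠ 0 ∧ raiseOp p qi' i (raiseOp p qj j x) - b • p i (p j x) ∈
      lowerPairs e p i j x := by
    refine ⟨1 - (shiftedDiff χ j i)⁻¹, h1, ?_⟩
    by_cases h0 : raiseOp p qj j x = 0
    · have := hp.p_raiseOp_sub_mem' (x := x) hij hqj
      rw [h0, map_zero] at this ⊢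
      exact this
    · exact hp.raiseOp_raiseOp_sub_mem' hij hqj (hqi' h0)
  have hwA : IsHW e (addWeight κ (addWeight κ χ i) j) (raiseOp p qj' j (raiseOp p qi i x)) := by
    by_cases h0 : raiseOp p qi i x = 0
    · rw [h0, map_zero]; exact isHW_zero _
    · exact hp.isHW_raiseOp (hp.isHW_raiseOp hx hqi) (hqj' h0)
  have hwB : IsHW e (addWeight κ (addWeight κ χ i) j) (raiseOp p qi' i (raiseOp p qj j x)) := by
    by_cases h0 : raiseOp p qj j x = 0
    · rw [h0, map_zero]; exact isHW_zero _
    · rw [← hcomm]; exact hp.isHW_raiseOp (hp.isHW_raiseOp hx hqj) (hqi' h0)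
  -- The ratio of leading coefficients removes p_i p_j x, leaving a highest weight vector in
  -- `lowerPairs`.
  refine ⟨b / a, div_ne_zero hb ha, sub_eq_zero.1 ?_⟩
  refine hp.eq_zero_of_mem_lowerPairs hx hχ hij (hwB.sub (hwA.smul _)) ?_
  have := Submodule.sub_mem _ hB (Submodule.smul_mem _ (b / a) hA)
  rwa [smul_sub, smul_smul, div_mul_cancel₀ _ ha, sub_sub_sub_cancel_right] at this

end IsStdAction

end SlStd

/-! ### Modules generated by a highest weight vector -/

namespace SlStd

open Module

variable {N : ℕ} {V : Type*} [AddCommGroup V] [Module ℂ V]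
variable {e : Fin N → Fin N → End ℂ V} {p : Fin N → End ℂ V} {κ : ℂ}

/-- `η` is strictly decreasing, in the sense of positive roots. -/
def IsStrictlyDecreasing (η : Fin N → ℂ) : Prop := ∀ i j, i < j → 0 < (η i - η j).re

/-- The weight `ψ` is strictly below `χ`. -/
def WeightBelow (ψ χ : Fin N → ℂ) : Prop :=
  ∀ η, IsStrictlyDecreasing η → (∑ k, ψ k * η k).re < (∑ k, χ k * η k).re

theorem sum_lower (χ η : Fin N → ℂ) (i j : Fin N) :
    ∑ k, (χ k + (if k = j then 1 else 0) - (if k = i then 1 else 0)) * η k =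
      ∑ k, χ k * η k - (η i - η j) := by
  simp [sub_mul, add_mul, Finset.sum_add_distrib, Finset.sum_sub_distrib]
  ring

/-- The operator by which the diagonal matrix with entries `η` acts. -/
noncomputable def diagOp (e : Fin N → Fin N → End ℂ V) (η : Fin N → ℂ) : End ℂ V :=
  ∑ k, η k • e k k

theorem IsWeight.diagOp_apply {χ : Fin N → ℂ} {x : V} (hx : IsWeight e χ x) (η : Fin N → ℂ) :
    diagOp e η x = (∑ k, χ k * η k) • x := by
  simp only [diagOp, LinearMap.sum_apply, LinearMap.smul_apply, hx _, smul_smul, Finset.sum_smul,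
    mul_comm]

/-- The span of the vectors of weight strictly below `χ`. -/
def belowSpan (e : Fin N → Fin N → End ℂ V) (χ : Fin N → ℂ) : Submodule ℂ V :=
  Submodule.span ℂ {y | ∃ ψ, WeightBelow ψ χ ∧ IsWeight e ψ y}

/-- The smallest submodule containing `x` and stable under the lowering operators. -/
def lowerClosure (e : Fin N → Fin N → End ℂ V) (x : V) : Submodule ℂ V :=
  sInf {W | x ∈ W ∧ ∀ i j, i < j → ∀ y ∈ W, e j i y ∈ W}

theorem mem_lowerClosure (x : V) : x ∈ lowerClosure e x :=
  Submodule.mem_sInf.2 fun _ hW => hW.1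

theorem lower_mem_lowerClosure {x y : V} {i j : Fin N} (hij : i < j)
    (hy : y ∈ lowerClosure e x) : e j i y ∈ lowerClosure e x :=
  Submodule.mem_sInf.2 fun W hW => hW.2 i j hij y (Submodule.mem_sInf.1 hy W hW)

namespace IsGlAction

variable (he : IsGlAction e)
include he

/-- This replaces an appeal to PBW: the vectors of the closure that every e_ij with i ≤ j keeps
inside it contain x and are stable under lowering, because commutators of matrix units are
combinations of matrix units. -/
theorem isInvariant_lowerClosure {χ : Fin N → ℂ} {x : V} (hx : IsHW e χ x) :
    IsInvariant e (lowerClosure e x) := by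
  let K : Submodule ℂ V := lowerClosure e x ⊓
    ⨅ (i : Fin N) (j : Fin N) (_ : i ≤ j), (lowerClosure e x).comap (e i j)
  have hK : ∀ y, y ∈ K ↔ y ∈ lowerClosure e x ∧ ∀ i j, i ≤ j → e i j y ∈ lowerClosure e x := by
    intro y
    simp [K, Submodule.mem_iInf]
  have hle : lowerClosure e x ≤ K := by
    refine sInf_le ⟨?_, fun i j hij y hy => ?_⟩
    · rw [hK]
      refine ⟨mem_lowerClosure x, fun i j hij => ?_⟩
      rcases hij.eq_or_lt with rfl | hij
      · rw [hx.weight i]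
        exact Submodule.smul_mem _ _ (mem_lowerClosure x)
      · rw [hx.raise i j hij]
        exact zero_mem _
    · rw [hK] at hy ⊢
      have hall : ∀ s t, e s t y ∈ lowerClosure e x := fun s t => by
        rcases le_or_gt s t with h | h
        · exact hy.2 s t h
        · exact lower_mem_lowerClosure h hy.1
      refine ⟨lower_mem_lowerClosure hij hy.1, fun s t hst => ?_⟩
      rw [he.apply_apply]
      refine Submodule.sub_mem _ (Submodule.add_mem _ (lower_mem_lowerClosure hij (hall s t)) ?_) ?_
      · split_ifs
        · exact hall _ _
        · exact zero_mem _
      · split_ifs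
        · exact hall _ _
        · exact zero_mem _
  intro i j y hy
  rcases le_or_gt i j with h | h
  · exact ((hK y).1 (hle hy)).2 i j h
  · exact lower_mem_lowerClosure h hy

/-- By the previous lemma only lowering operators matter, and each of them sends x and the lower
weight vectors to strictly lower weights. -/
theorem invClosure_le_sup {χ : Fin N → ℂ} {x : V} (hx : IsHW e χ x) :
    invClosure e {x} ≤ Submodule.span ℂ {x} ⊔ belowSpan e χ := by
  refine (invClosure_le (by simpa using mem_lowerClosure x) (he.isInvariant_lowerClosure hx)).trans
    (sInf_le ⟨Submodule.mem_sup_left (Submodule.mem_span_singleton_self x), ?_⟩)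
  intro i j hij y hy
  have hlow : ∀ (ψ : Fin N → ℂ) (z : V), IsWeight e ψ z → (ψ = χ ∨ WeightBelow ψ χ) →
      e j i z ∈ belowSpan e χ := by
    intro ψ z hz h
    refine Submodule.subset_span ⟨_, fun η hη => ?_, he.isWeight_apply hz j i⟩
    have h1 := hη i j hij
    rw [sum_lower, Complex.sub_re]
    rcases h with rfl | h
    · linarith
    · linarith [h η hη]
  suffices H : Submodule.span ℂ {x} ⊔ belowSpan e χ ≤ (belowSpan e χ).comap (e j i) from
    Submodule.mem_sup_right (H hy)
  refine sup_le ?_ ?_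
  · rw [Submodule.span_singleton_le_iff_mem]
    exact hlow χ x hx.weight (.inl rfl)
  · refine Submodule.span_le.2 ?_
    rintro z ⟨ψ, hψ, hz⟩
    exact hlow ψ z hz (.inr hψ)

/-- Highest weight vectors in the module generated by one are multiples of it. -/
theorem mem_span_of_mem_invClosure [FiniteDimensional ℂ V] {χ ψ : Fin N → ℂ} {x y : V}
    (hx : IsHW e χ x) (hy : IsHW e ψ y) (hmem : y ∈ invClosure e {x}) :
    y ∈ Submodule.span ℂ {x} := by
  by_contra hcon
  have hy0 : y ≠ 0 := fun h => hcon (h ▸ zero_mem _)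
  have hx0 : x ≠ 0 := by
    rintro rfl
    have : invClosure e {(0 : V)} ≤ ⊥ := invClosure_le (by simp) (fun i j z hz => by
      rw [Submodule.mem_bot] at hz ⊢; rw [hz, map_zero])
    exact hy0 (by simpa using this hmem)
  have hχ := hx.isDominant he hx0
  have hψ := hy.isDominant he hy0
  -- The Casimir operator is scalar on the whole module generated by x.
  have hcas : casimirValue χ = casimirValue ψ := by
    have h1 : invClosure e {x} ≤ LinearMap.ker (casimir e - casimirValue χ • (1 : End ℂ V)) := by
      refine invClosure_le ?_ fun i j z hz => ?_
      · simp [he.casimir_apply_of_isHW hx]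
      · rw [LinearMap.mem_ker, LinearMap.sub_apply, sub_eq_zero] at hz ⊢
        rw [← Module.End.mul_apply, ← (he.commute_casimir i j).eq, Module.End.mul_apply, hz]
        simp
    have h2 := h1 hmem
    rw [LinearMap.mem_ker, LinearMap.sub_apply, he.casimir_apply_of_isHW hy, LinearMap.smul_apply,
      Module.End.one_apply, ← sub_smul] at h2
    exact (sub_eq_zero.1 ((smul_eq_zero.1 h2).resolve_right hy0)).symm
  -- This is χ + ψ + 2ρ. It is strictly decreasing as χ and ψ are dominant, and equality of the
  -- Casimir values says that χ and ψ pair equally with it. So the component of y outside the line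
  -- of x has the eigenvalue of χ while being a sum of vectors with other eigenvalues.
  set η : Fin N → ℂ := fun k => χ k + ψ k + N - 1 - 2 * (k : ℕ) with hη
  have hdec : IsStrictlyDecreasing η := by
    intro i j hij
    obtain ⟨a, ha⟩ := hχ i j hij
    obtain ⟨b, hb⟩ := hψ i j hij
    have hij' : (i : ℕ) < j := hij
    have : η i - η j = (a + b + 2 * ((j : ℕ) - (i : ℕ)) : ℝ) := by
      rw [hη]; push_cast; rw [← ha, ← hb]; ring
    rw [this, Complex.ofReal_re]
    have h3 : ((i : ℕ) : ℝ) < (j : ℕ) := by exact_mod_cast hij'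
    have h4 : (0 : ℝ) ≤ a := by positivity
    have h5 : (0 : ℝ) ≤ b := by positivity
    linarith
  have hsum : ∑ k, ψ k * η k = ∑ k, χ k * η k := by
    have := casimirValue_sub χ ψ
    rw [hcas, sub_self] at this
    rw [eq_comm, ← sub_eq_zero, ← Finset.sum_sub_distrib, this]
    exact Finset.sum_congr rfl fun k _ => by rw [hη]; ring
  obtain ⟨u, hu, z, hz, huz⟩ := Submodule.mem_sup.1 (he.invClosure_le_sup hx hmem)
  obtain ⟨c, rfl⟩ := Submodule.mem_span_singleton.1 hu
  have hz1 : z ∈ offEigen (diagOp e η) (∑ k, χ k * η k) := by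
    refine Submodule.span_le.2 ?_ hz
    rintro v ⟨φ, hφ, hv⟩
    refine mem_offEigen_of_apply_eq (fun h => ?_) (hv.diagOp_apply η)
    have := hφ η hdec
    rw [h] at this
    exact lt_irrefl _ this
  have hz2 : diagOp e η z = (∑ k, χ k * η k) • z := by
    rw [← add_sub_cancel_left (c • x) z, huz, map_sub, hy.weight.diagOp_apply, map_smul,
      hx.weight.diagOp_apply, hsum, smul_sub, smul_comm]
  rw [eq_zero_of_mem_offEigen hz1 hz2, add_zero] at huz
  exact hcon (huz ▸ hu)

/-- Commuting operators on a non-zero finite dimensional space have a common eigenvector. -/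
theorem exists_isWeight [FiniteDimensional ℂ V] {W : Submodule ℂ V} (hW : W ≠ ⊥)
    (hinv : IsInvariant e W) : ∃ χ, ∃ x ∈ W, x ≠ 0 ∧ IsWeight e χ x := by
  suffices H : ∀ s : Finset (Fin N), ∀ W : Submodule ℂ V, W ≠ ⊥ → (∀ k, ∀ x ∈ W, e k k x ∈ W) →
      ∃ χ : Fin N → ℂ, ∃ x ∈ W, x ≠ 0 ∧ ∀ k ∈ s, e k k x = χ k • x by
    obtain ⟨χ, x, hx, h0, h⟩ := H Finset.univ W hW fun k => hinv k k
    exact ⟨χ, x, hx, h0, fun k => h k (Finset.mem_univ k)⟩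
  intro s
  induction s using Finset.induction_on with
  | empty =>
    intro W hW _
    obtain ⟨x, hx, h0⟩ := W.ne_bot_iff.1 hW
    exact ⟨0, x, hx, h0, by simp⟩
  | insert a s ha ih =>
    intro W hW hinv
    have : Nontrivial W := Submodule.nontrivial_iff_ne_bot.2 hW
    obtain ⟨c, hc⟩ := Module.End.exists_eigenvalue ((e a a).restrict (hinv a))
    obtain ⟨w, hw⟩ := hc.exists_hasEigenvector
    have hw1 : e a a w = c • (w : V) := by
      simpa [Subtype.ext_iff] using hw.apply_eq_smul
    have hw0 : (w : V) ≠ 0 := by simpa using hw.2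
    obtain ⟨χ, x, hx, h0, h⟩ := ih (W ⊓ LinearMap.ker (e a a - c • (1 : End ℂ V)))
      (Submodule.ne_bot_iff _ |>.2 ⟨w, ⟨w.2, by simp [hw1]⟩, hw0⟩) (by
        intro k x hx
        obtain ⟨hx1, hx2⟩ := hx
        refine ⟨hinv k x hx1, ?_⟩
        simp only [SetLike.mem_coe, LinearMap.mem_ker, LinearMap.sub_apply, LinearMap.smul_apply,
          Module.End.one_apply, sub_eq_zero] at hx2 ⊢
        rw [he.apply_apply, hx2, map_smul]
        by_cases hak : a = k
        · subst hak; simp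
        · simp [hak, Ne.symm hak])
    refine ⟨Function.update χ a c, x, hx.1, h0, fun k hk => ?_⟩
    by_cases hka : k = a
    · subst hka
      have := hx.2
      simp only [SetLike.mem_coe, LinearMap.mem_ker, LinearMap.sub_apply, LinearMap.smul_apply,
          Module.End.one_apply, sub_eq_zero] at this
      simpa using this
    · rw [Function.update_of_ne hka]
      exact h k ((Finset.mem_insert.1 hk).resolve_left hka)

theorem exists_isHW [FiniteDimensional ℂ V] {W : Submodule ℂ V} (hW : W ≠ ⊥)
    (hinv : IsInvariant e W) : ∃ χ, ∃ x ∈ W, x ≠ 0 ∧ IsHW e χ x := by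
  -- With these entries a nonzero e_ij x, i < j, has eigenvalue larger by j - i, so a weight vector
  -- with eigenvalue of maximal real part is killed.
  set η : Fin N → ℂ := fun k => -((k : ℕ) : ℂ) with hη
  let Z : Set ℂ := {z | ∃ χ, ∃ x ∈ W, x ≠ 0 ∧ IsWeight e χ x ∧ z = ∑ k, χ k * η k}
  have hZ : Z.Finite := by
    refine (Module.End.finite_hasEigenvalue (diagOp e η)).subset ?_
    rintro z ⟨χ, x, _, h0, hx, rfl⟩
    exact Module.End.hasEigenvalue_of_hasEigenvector
      ⟨Module.End.mem_eigenspace_iff.2 (hx.diagOp_apply η), h0⟩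
  have hne : Z.Nonempty := by
    obtain ⟨χ, x, hx, h0, h⟩ := he.exists_isWeight hW hinv
    exact ⟨_, χ, x, hx, h0, h, rfl⟩
  obtain ⟨z, ⟨χ, x, hx, h0, h, rfl⟩, hmax⟩ := hZ.exists_maximalFor Complex.re Z hne
  refine ⟨χ, x, hx, h0, h, fun i j hij => ?_⟩
  by_contra hcon
  have hij' : ((i : ℕ) : ℝ) < (j : ℕ) := by exact_mod_cast hij
  have h1 := hmax ⟨_, _, hinv i j x hx, hcon, he.isWeight_apply h i j, rfl⟩
  rw [sum_lower] at h1
  simp only [Complex.sub_re, hη, Complex.neg_re, Complex.natCast_re] at h1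
  have h2 := h1 (by linarith)
  linarith

/-- Any linear relation between elements of modules generated by highest weight vectors gives rise
to one between multiples of these vectors, all of the same weight. -/
theorem exists_relation [FiniteDimensional ℂ V] {ι : Type*} {w : ι → V} {χ : ι → Fin N → ℂ}
    (hw : ∀ k, IsHW e (χ k) (w k)) (s : Finset ι) (u : ι → V)
    (hu : ∀ k ∈ s, u k ∈ invClosure e {w k}) (hsum : ∑ k ∈ s, u k = 0) (hne : ∃ k ∈ s, u k ≠ 0) :
    ∃ (c : ι → ℂ) (ν : Fin N → ℂ), ∑ k ∈ s, c k • w k = 0 ∧ (∃ k ∈ s, c k • w k ≠ 0) ∧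
      ∀ k ∈ s, c k • w k ≠ 0 → χ k = ν := by
  classical
  let E : Fin N → Fin N → End ℂ (s → V) := fun i j => (e i j).compLeft s
  have hE : IsGlAction E := by
    intro i j k l
    refine LinearMap.ext fun y => funext fun a => ?_
    have := he.apply_apply i j k l (y a)
    simp only [E, Module.End.mul_apply, LinearMap.add_apply, LinearMap.sub_apply,
      LinearMap.compLeft_apply, Function.comp_apply, Pi.add_apply, Pi.sub_apply]
    rw [this]
    split_ifs <;> simp
  let S : (s → V) →ₗ[ℂ] V := ∑ k : s, LinearMap.proj k
  have hS : ∀ y : s → V, S y = ∑ k : s, y k := fun y => by simp [S]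
  -- The relations form a module under the diagonal action. If it is nonzero it contains a highest
  -- weight vector, whose components are highest weight vectors in the modules generated by the w_k,
  -- hence multiples of the w_k.
  let W : Submodule ℂ (s → V) :=
    Submodule.pi Set.univ (fun k : s => invClosure e {w k}) ⊓ LinearMap.ker S
  have hWmem : ∀ y, y ∈ W ↔ (∀ k : s, y k ∈ invClosure e {w k}) ∧ ∑ k : s, y k = 0 := by
    intro y
    simp [W, hS, Submodule.mem_pi]
  have hinv : IsInvariant E W := by
    intro i j y hy
    rw [hWmem] at hy ⊢
    refine ⟨fun k => isInvariant_invClosure _ i j _ (hy.1 k), ?_⟩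
    have := congrArg (e i j) hy.2
    rwa [map_sum, map_zero] at this
  have hbot : W ≠ ⊥ := by
    obtain ⟨k, hk, hk0⟩ := hne
    refine (Submodule.ne_bot_iff _).2 ⟨fun k => u k, ?_, fun h => hk0 (congrFun h ⟨k, hk⟩)⟩
    rw [hWmem]
    exact ⟨fun k => hu k k.2, by rw [Finset.sum_coe_sort s u, hsum]⟩
  obtain ⟨ν, x, hx, hx0, hxν⟩ := hE.exists_isHW hbot hinv
  rw [hWmem] at hx
  have hxk : ∀ k : s, IsHW e ν (x k) := fun k =>
    ⟨fun a => congrFun (hxν.weight a) k, fun i j hij => congrFun (hxν.raise i j hij) k⟩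
  choose c hc using fun k : s =>
    Submodule.mem_span_singleton.1 (he.mem_span_of_mem_invClosure (hw k) (hxk k) (hx.1 k))
  let c' : ι → ℂ := fun k => if h : k ∈ s then c ⟨k, h⟩ else 0
  have hc' : ∀ k : s, c' k • w k = x k := fun k => by simp [c', hc]
  refine ⟨c', ν, ?_, ?_, fun k hk hk0 => ?_⟩
  · rw [← Finset.sum_coe_sort s (fun k => c' k • w k), ← hx.2]
    exact Finset.sum_congr rfl fun k _ => hc' k
  · obtain ⟨k, hk⟩ := Function.ne_iff.1 hx0
    exact ⟨k, k.2, by rw [hc']; exact hk⟩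
  · funext a
    have h1 := ((hw k).smul (c' k)).weight a
    have h2 := (hxk ⟨k, hk⟩).weight a
    rw [← hc' ⟨k, hk⟩, h1, ← sub_eq_zero, ← sub_smul] at h2
    exact sub_eq_zero.1 ((smul_eq_zero.1 h2).resolve_right hk0)

end IsGlAction

/-! ### Nilpotence of the ideal and Nakayama's lemma -/

namespace IsStdAction

variable (hp : IsStdAction e p κ)
include hp

/-- Every nonzero power p_a^r is an eigenvector of the commutator with e_aa, of eigenvalue r(1 - κ).
These are distinct, and End V has finite dimension. -/
theorem exists_pow_p_eq_zero [FiniteDimensional ℂ V] (hκ : κ ≠ 1) (a : Fin N) :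
    ∃ r, p a ^ r = 0 := by
  by_contra! hcon
  have hpow : ∀ r : ℕ, e a a * p a ^ r - p a ^ r * e a a = ((r : ℂ) * (1 - κ)) • p a ^ r := by
    intro r
    induction r with
    | zero => simp
    | succ r ih =>
      have h1 : e a a * p a = p a * e a a + (1 - κ) • p a := by
        rw [hp.mul]; simp [sub_smul, add_sub_assoc]
      rw [sub_eq_iff_eq_add] at ih
      rw [pow_succ, ← mul_assoc, ih, add_mul, mul_assoc (p a ^ r) (e a a), h1, mul_add,
        smul_mul_assoc, mul_smul_comm, mul_assoc]
      push_cast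
      module
  let T : End ℂ (End ℂ V) := LinearMap.mulLeft ℂ (e a a) - LinearMap.mulRight ℂ (e a a)
  refine Set.infinite_of_injective_forall_mem (f := fun r : ℕ => (r : ℂ) * (1 - κ)) ?_ ?_
    (Module.End.finite_hasEigenvalue T)
  · intro r s hrs
    exact_mod_cast mul_right_cancel₀ (sub_ne_zero.2 hκ.symm) hrs
  · intro r
    exact Module.End.hasEigenvalue_of_hasEigenvector
      ⟨Module.End.mem_eigenspace_iff.2 (hpow r), hcon r⟩

/-- A form of Nakayama's lemma. -/
theorem eq_bot_of_le_iSup_map [FiniteDimensional ℂ V] (hκ : κ ≠ 1) {M : Submodule ℂ V}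
    (hM : ∀ a, ∀ x ∈ M, p a x ∈ M) (hle : M ≤ ⨆ a, M.map (p a)) : M = ⊥ := by
  suffices H : ∀ s : Finset (Fin N), M ≤ ⨆ a ∈ s, M.map (p a) → M = ⊥ from
    H Finset.univ (by simpa using hle)
  intro s
  induction s using Finset.induction_on with
  | empty => intro h; simpa using h
  | insert a s _ ih =>
    intro h
    apply ih
    set R := ⨆ b ∈ s, M.map (p b) with hR
    rw [Finset.iSup_insert] at h
    have hRa : R.map (p a) ≤ R := by
      rw [hR, Submodule.map_iSup]
      refine iSup_mono fun b => ?_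
      rw [Submodule.map_iSup]
      refine iSup_mono fun _ => ?_
      rintro _ ⟨_, ⟨x, hx, rfl⟩, rfl⟩
      exact ⟨p a x, hM a x hx, hp.p_p b a x⟩
    -- Since p_a preserves R, the inclusion M ≤ p_a M + R can be iterated; nilpotence then removes a
    -- from the index set.
    have hpow : ∀ r : ℕ, M ≤ M.map (p a ^ r) ⊔ R := by
      intro r
      induction r with
      | zero => exact le_sup_of_le_left (by rintro x hx; exact ⟨x, hx, by simp⟩)
      | succ r ihr =>
        refine h.trans (sup_le ((Submodule.map_mono ihr).trans ?_) le_sup_right)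
        rw [Submodule.map_sup]
        refine sup_le_sup (le_of_eq ?_) hRa
        rw [pow_succ', Module.End.mul_eq_comp, Submodule.map_comp]
    obtain ⟨r, hr⟩ := hp.exists_pow_p_eq_zero hκ a
    simpa [hr] using hpow r

end IsStdAction

end SlStd

/-! ### Enveloping algebras and traceless matrix units -/

namespace SlStd

open Module

section UEA

variable {L V : Type*} [LieRing L] [LieAlgebra ℂ L] [AddCommGroup V] [Module ℂ V]
  {ρ : L →ₗ⁅ℂ⁆ Module.End ℂ V}

/-- The representation factors through the subalgebra of endomorphisms preserving W, and by
uniqueness so does its extension to the enveloping algebra. -/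
theorem lift_apply_mem {W : Submodule ℂ V} (hW : ∀ X, ∀ x ∈ W, ρ X x ∈ W)
    (u : UniversalEnvelopingAlgebra ℂ L) :
    ∀ x ∈ W, UniversalEnvelopingAlgebra.lift ℂ ρ u x ∈ W := by
  let A : Subalgebra ℂ (Module.End ℂ V) :=
    { carrier := {T | ∀ x ∈ W, T x ∈ W}
      mul_mem' := fun {a b} ha hb x hx => ha _ (hb x hx)
      add_mem' := fun {a b} ha hb x hx => W.add_mem (ha x hx) (hb x hx)
      algebraMap_mem' := fun r x hx => by
        rw [Module.algebraMap_end_apply]; exact W.smul_mem r hx }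
  let ρA : L →ₗ⁅ℂ⁆ A :=
    { toFun := fun X => ⟨ρ X, hW X⟩
      map_add' := fun X Y => Subtype.ext (map_add ρ X Y)
      map_smul' := fun c X => Subtype.ext (map_smul ρ c X)
      map_lie' := fun {X Y} => Subtype.ext (LieHom.map_lie ρ X Y) }
  have h : A.val.comp (UniversalEnvelopingAlgebra.lift ℂ ρA) =
      UniversalEnvelopingAlgebra.lift ℂ ρ := by
    apply UniversalEnvelopingAlgebra.hom_ext
    ext X : 1
    simp [ρA]
  intro x hx
  rw [← h]
  exact (UniversalEnvelopingAlgebra.lift ℂ ρA u).2 x hx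

theorem mem_generated_self (v : V) : v ∈ generated ρ v :=
  ⟨1, by simp⟩

theorem apply_mem_generated {v x : V} (X : L) (hx : x ∈ generated ρ v) :
    ρ X x ∈ generated ρ v := by
  obtain ⟨u, rfl⟩ := hx
  exact ⟨UniversalEnvelopingAlgebra.ι ℂ X * u, by simp⟩

theorem generated_le {v : V} {W : Submodule ℂ V} (hv : v ∈ W) (hW : ∀ X, ∀ x ∈ W, ρ X x ∈ W) :
    generated ρ v ≤ W := by
  rintro _ ⟨u, rfl⟩
  exact lift_apply_mem hW u v hv

end UEA

variable {n : ℕ}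

/-- The traceless part of the matrix unit `A_{i,j}`. -/
noncomputable def slUnit (i j : Fin (n + 1)) : Sl n :=
  ⟨Matrix.single i j 1 - (if i = j then ((n : ℂ) + 1)⁻¹ else 0) • 1, by
    have h : (n : ℂ) + 1 ≠ 0 := Nat.cast_add_one_ne_zero n
    change Matrix.trace (_ : Matrix (Fin (n + 1)) (Fin (n + 1)) ℂ) = 0
    by_cases hij : i = j
    · subst hij; simp [h]
    · simp [hij]⟩

theorem slUnit_val (i j : Fin (n + 1)) : (slUnit i j : Sl n).1 =
    Matrix.single i j 1 - (if i = j then ((n : ℂ) + 1)⁻¹ else 0) • 1 := rfl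

theorem trace_val (X : Sl n) : Matrix.trace X.1 = 0 := X.2

theorem matUnit_eq (i j : Fin (n + 1)) (h : i ≠ j) : matUnit i j h = slUnit i j := by
  apply Subtype.ext
  rw [slUnit_val, if_neg h, zero_smul, sub_zero]
  rfl

theorem H_eq (t : Fin n) : H t = slUnit t.castSucc t.castSucc - slUnit t.succ t.succ := by
  apply Subtype.ext
  change Matrix.single _ _ _ - Matrix.single _ _ _ = (slUnit _ _).1 - (slUnit _ _).1
  rw [slUnit_val, slUnit_val, if_pos rfl, if_pos rfl]
  abel

theorem sum_smul_slUnit (X : Sl n) : X = ∑ i, ∑ j, X.1 i j • slUnit i j := by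
  apply Subtype.ext
  have h1 : (∑ i, ∑ j, X.1 i j • slUnit i j : Sl n).1 =
      ∑ i, ∑ j, X.1 i j • (slUnit i j : Sl n).1 := by
    simp
  rw [h1]
  simp only [slUnit_val, smul_sub, Finset.sum_sub_distrib]
  have h2 : ∑ i, ∑ j, X.1 i j • (if i = j then ((n : ℂ) + 1)⁻¹ else 0) •
      (1 : Matrix (Fin (n + 1)) (Fin (n + 1)) ℂ) = 0 := by
    have h3 := trace_val X
    simp only [ite_smul, zero_smul, smul_ite, smul_zero, Finset.sum_ite_eq, Finset.mem_univ,
      if_true, ← Finset.sum_smul]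
    rw [Matrix.trace] at h3
    simp only [Matrix.diag_apply] at h3
    rw [h3, zero_smul]
  rw [h2, sub_zero]
  conv_lhs => rw [Matrix.matrix_eq_sum_single X.1]
  simp [Matrix.smul_single]

/-- Scalar matrices do not affect commutators; on the right the trace corrections occur only if j =
k and i = l, and then they cancel. -/
theorem slUnit_lie (i j k l : Fin (n + 1)) : ⁅(slUnit i j : Sl n), slUnit k l⁆ =
    (if j = k then slUnit i l else 0) - (if l = i then slUnit k j else 0) := by
  apply Subtype.ext
  have h1 : (⁅(slUnit i j : Sl n), slUnit k l⁆ : Sl n).1 =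
      (slUnit i j : Sl n).1 * (slUnit k l : Sl n).1 -
        (slUnit k l : Sl n).1 * (slUnit i j : Sl n).1 := rfl
  have h2 : ((if j = k then slUnit i l else 0) - (if l = i then slUnit k j else 0) : Sl n).1 =
      (if j = k then (slUnit i l : Sl n).1 else 0) -
        (if l = i then (slUnit k j : Sl n).1 else 0) := by
    split_ifs <;> simp
  rw [h1, h2]
  simp only [slUnit_val]
  have h3 : Matrix.single i j (1 : ℂ) * Matrix.single k l 1 =
      if j = k then Matrix.single i l 1 else 0 := by
    split_ifs with h
    · subst h; simp
    · rw [Matrix.single_mul_single_of_ne _ _ _ _ h]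
  have h4 : Matrix.single k l (1 : ℂ) * Matrix.single i j 1 =
      if l = i then Matrix.single k j 1 else 0 := by
    split_ifs with h
    · subst h; simp
    · rw [Matrix.single_mul_single_of_ne _ _ _ _ h]
  have h5 : ∀ (A B : Matrix (Fin (n + 1)) (Fin (n + 1)) ℂ) (a b : ℂ),
      (A - a • 1) * (B - b • 1) - (B - b • 1) * (A - a • 1) = A * B - B * A := by
    intro A B a b
    simp only [sub_mul, mul_sub, smul_mul_assoc, mul_smul_comm, one_mul, mul_one, smul_sub,
      smul_smul, mul_comm b a]
    abel
  rw [h5, h3, h4]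
  by_cases h6 : j = k
  · subst h6
    by_cases h7 : l = i
    · subst h7; simp
    · simp [h7, Ne.symm h7]
  · by_cases h7 : l = i
    · subst h7; simp [h6, Ne.symm h6]
    · simp [h6, h7]

theorem inr_lie_inl (X : Sl n) (a : Std n) :
    ⁅inclSl n X, SemiDirectSum.inl (stdAction n) a⁆ =
      SemiDirectSum.inl (stdAction n) (stdAction n X a) := by
  simp

theorem stdAction_slUnit (i j k : Fin (n + 1)) :
    stdAction n (slUnit i j) ((coords n).symm (Pi.single k 1)) =
      (if j = k then (coords n).symm (Pi.single i 1) else 0) -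
        (if i = j then ((n : ℂ) + 1)⁻¹ • (coords n).symm (Pi.single k 1) else 0) := by
  have h : stdAction n (slUnit i j) ((coords n).symm (Pi.single k 1)) =
      (coords n).symm ((slUnit i j : Sl n).1.mulVec (Pi.single k 1)) := rfl
  have h1 : (Matrix.single i j (1 : ℂ)).mulVec (Pi.single k 1) =
      if j = k then Pi.single i 1 else 0 := by
    ext a
    split_ifs with hjk
    · subst hjk
      simp [Matrix.single_apply, Pi.single_apply, eq_comm]
    · simp [hjk]
  rw [h, slUnit_val, Matrix.sub_mulVec, Matrix.smul_mulVec, Matrix.one_mulVec, h1, map_sub]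
  split_ifs <;> simp

theorem inclSl_lie_P (i j k : Fin (n + 1)) : ⁅inclSl n (slUnit i j), P k⁆ =
    (if j = k then P i else 0) - (if i = j then ((n : ℂ) + 1)⁻¹ • P k else 0) := by
  rw [P, inr_lie_inl, stdAction_slUnit, map_sub]
  congr 1
  · split_ifs
    · rfl
    · exact map_zero _
  · split_ifs
    · exact map_smul _ _ _
    · exact map_zero _

theorem eq_sum_P_add (X : G n) : X = ∑ a, coords n X.left a • P a + inclSl n X.right := by
  have h : X.left = ∑ a, coords n X.left a • (coords n).symm (Pi.single a 1) := by
    apply (coords n).injective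
    rw [map_sum]
    simp only [map_smul, LinearEquiv.apply_symm_apply]
    exact pi_eq_sum_univ' _
  have h1 : X = SemiDirectSum.inl (stdAction n) X.left + inclSl n X.right := by
    ext <;> simp
  conv_lhs => rw [h1, h, map_sum]
  simp only [map_smul]
  rfl

theorem P_lie_P (a b : Fin (n + 1)) : ⁅(P a : G n), P b⁆ = 0 := by
  rw [P, P, ← LieHom.map_lie]
  exact map_zero _

/-! ### From the recursive Q and φ to normalised raising operators -/

section Representation

variable (n) (V : Type*) [AddCommGroup V] [Module ℂ V] [LieRingModule (G n) V]
  [LieModule ℂ (G n) V]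

/-- The action of the traceless part of the matrix unit `A_{i,j}`. -/
noncomputable def glOp (i j : Fin (n + 1)) : End ℂ V := repSl n V (slUnit i j)

/-- The action of `P_k`. -/
def pOp (k : Fin (n + 1)) : End ℂ V := rep n V (P k)

theorem isStdAction_rep : IsStdAction (glOp n V) (pOp n V) ((n : ℂ) + 1)⁻¹ := by
  refine ⟨fun i j k l => ?_, fun i j k => ?_, fun a b => ?_⟩
  · have := congrArg (repSl n V) (slUnit_lie i j k l)
    rw [LieHom.map_lie, LieRing.of_associative_ring_bracket, sub_eq_iff_eq_add] at this
    simp only [glOp]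
    rw [this]
    split_ifs <;> simp <;> abel
  · have := congrArg (rep n V) (inclSl_lie_P i j k)
    rw [LieHom.map_lie, LieRing.of_associative_ring_bracket, sub_eq_iff_eq_add] at this
    change rep n V (inclSl n (slUnit i j)) * rep n V (P k) = rep n V (P k) *
      rep n V (inclSl n (slUnit i j)) + (if j = k then rep n V (P i) else 0) -
      (if i = j then ((n : ℂ) + 1)⁻¹ • rep n V (P k) else 0)
    rw [this]
    split_ifs <;> simp only [map_sub, map_zero, map_smul] <;> abel
  · have := congrArg (rep n V) (P_lie_P a b)
    rwa [LieHom.map_lie, LieRing.of_associative_ring_bracket, map_zero, sub_eq_zero] at this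

variable {n V}

theorem repSl_mem {W : Submodule ℂ V} (hW : IsInvariant (glOp n V) W) (X : Sl n) :
    ∀ x ∈ W, repSl n V X x ∈ W := by
  intro x hx
  rw [sum_smul_slUnit X]
  simp only [map_sum, LinearMap.sum_apply, map_smul, LinearMap.smul_apply]
  exact W.sum_mem fun i _ => W.sum_mem fun j _ => W.smul_mem _ (hW i j x hx)

theorem generated_repSl (v : V) : generated (repSl n V) v = invClosure (glOp n V) {v} :=
  le_antisymm
    (generated_le (subset_invClosure _ rfl) (repSl_mem (isInvariant_invClosure _)))
    (invClosure_le (by simpa using mem_generated_self v) fun _ _ _ hx => apply_mem_generated _ hx)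

theorem rep_mem {W : Submodule ℂ V} (hW : IsInvariant (glOp n V) W)
    (hWp : ∀ a, ∀ x ∈ W, pOp n V a x ∈ W) (X : G n) : ∀ x ∈ W, rep n V X x ∈ W := by
  intro x hx
  rw [eq_sum_P_add X, map_add, LinearMap.add_apply, map_sum, LinearMap.sum_apply]
  refine W.add_mem (W.sum_mem fun a _ => ?_) (repSl_mem hW X.right x hx)
  rw [map_smul]
  exact W.smul_mem _ (hWp a x hx)

/-- The weights `χ` and `μ` agree on the simple coroots. -/
def IsCompatible (χ : Fin (n + 1) → ℂ) (μ : Weight n) : Prop :=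
  ∀ t : Fin n, χ t.castSucc - χ t.succ = μ t

theorem IsCompatible.addWeight {χ : Fin (n + 1) → ℂ} {μ : Weight n} (h : IsCompatible χ μ) (κ : ℂ)
    (i : Fin (n + 1)) : IsCompatible (addWeight κ χ i)
      (μ + fundWeight n ((i : ℕ) + 1) - fundWeight n (i : ℕ)) := by
  intro t
  simp only [SlStd.addWeight, Pi.add_apply, Pi.sub_apply, ← h t, fundWeight, Fin.ext_iff,
    Fin.val_castSucc, Fin.val_succ, add_left_inj]
  ring

theorem IsCompatible.mu_eq {χ : Fin (n + 1) → ℂ} {μ : Weight n} (h : IsCompatible χ μ)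
    {k i : Fin (n + 1)} (hk : k ≤ i) : mu μ k i = shiftedDiff χ i k := by
  suffices H : ∀ i : Fin (n + 1), k ≤ i →
      ∑ t : Fin n with k ≤ t.castSucc ∧ t.castSucc < i, (μ t + 1) =
        (χ k - (k : ℕ)) - (χ i - (i : ℕ)) by
    rw [mu, H i hk, shiftedDiff]; ring
  intro i
  induction i using Fin.induction with
  | zero =>
    intro hk
    have : k = 0 := Fin.le_zero_iff.1 hk
    subst this
    simp
  | succ j ih =>
    intro hk
    rcases hk.eq_or_lt with rfl | hk
    · rw [sub_self]
      refine Finset.sum_eq_zero fun t ht => ?_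
      rw [Finset.mem_filter] at ht
      exact absurd ht.2.2 ht.2.1.not_gt
    · have hkj : k ≤ j.castSucc := by rw [Fin.le_def]; rw [Fin.lt_def] at hk; simp at *; omega
      have hset : (Finset.univ.filter fun t : Fin n => k ≤ t.castSucc ∧ t.castSucc < j.succ) =
          insert j (Finset.univ.filter fun t : Fin n => k ≤ t.castSucc ∧ t.castSucc < j.castSucc) := by
        ext t
        simp only [Finset.mem_filter, Finset.mem_univ, true_and, Finset.mem_insert, Fin.le_def,
          Fin.lt_def, Fin.val_castSucc, Fin.val_succ, Fin.ext_iff] at *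
        omega
      rw [hset, Finset.sum_insert (by simp), ih hkj, ← h j]
      simp only [Fin.val_castSucc, Fin.val_succ]
      push_cast
      ring

/-- The coroots fix only differences of the diagonal eigenvalues; the traceless diagonal units add
up to zero, which fixes the common constant. -/
theorem IsHighestWeightVector.exists_isHW {μ : Weight n} {v : V}
    (hv : IsHighestWeightVector μ v) : ∃ χ, IsCompatible χ μ ∧ IsHW (glOp n V) χ v := by
  have hdiff : ∀ t : Fin n, glOp n V t.castSucc t.castSucc v - glOp n V t.succ t.succ v = μ t • v := by
    intro t
    rw [← hv.weight t, H_eq, map_sub]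
    rfl
  have hsum : ∑ k, glOp n V k k v = 0 := by
    have : ∑ k : Fin (n + 1), (slUnit k k : Sl n) = 0 := by
      apply Subtype.ext
      have h1 : (∑ k : Fin (n + 1), (slUnit k k : Sl n)).1 =
          ∑ k : Fin (n + 1), (slUnit k k : Sl n).1 := by simp
      rw [h1]
      simp only [slUnit_val, if_true]
      rw [Finset.sum_sub_distrib, Matrix.sum_single_one, Finset.sum_const, Finset.card_univ,
        Fintype.card_fin, ← Nat.cast_smul_eq_nsmul ℂ, smul_smul, Nat.cast_add, Nat.cast_one,
        mul_inv_cancel₀ (Nat.cast_add_one_ne_zero n), one_smul, sub_self]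
      rfl
    have h2 := congrArg (fun X => repSl n V X v) this
    simpa [glOp] using h2
  have hχ : ∃ χ : Fin (n + 1) → ℂ, ∀ k, glOp n V k k v = χ k • v := by
    have h1 : ∀ k, ∃ c : ℂ, glOp n V k k v = c • v + glOp n V 0 0 v := by
      intro k
      induction k using Fin.induction with
      | zero => exact ⟨0, by simp⟩
      | succ t ih =>
        obtain ⟨c, hc⟩ := ih
        refine ⟨c - μ t, ?_⟩
        rw [sub_smul, ← hdiff t, hc]
        abel
    choose c hc using h1
    have h0 : (n : ℂ) + 1 ≠ 0 := Nat.cast_add_one_ne_zero n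
    have h2 : glOp n V 0 0 v = (-((n : ℂ) + 1)⁻¹ * ∑ k, c k) • v := by
      rw [Finset.sum_congr rfl fun k _ => hc k, Finset.sum_add_distrib, ← Finset.sum_smul,
        Finset.sum_const, Finset.card_univ, Fintype.card_fin] at hsum
      apply smul_right_injective _ h0
      beta_reduce
      rw [smul_smul, ← mul_assoc, mul_neg, mul_inv_cancel₀ h0, neg_one_mul, neg_smul,
        eq_neg_iff_add_eq_zero, add_comm, ← hsum, ← Nat.cast_smul_eq_nsmul ℂ]
      push_cast
      rfl
    exact ⟨fun k => c k + -((n : ℂ) + 1)⁻¹ * ∑ k, c k, fun k => by rw [add_smul, ← h2, hc]⟩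
  obtain ⟨χ, hχ⟩ := hχ
  refine ⟨χ, fun t => ?_, hχ, fun i j hij => ?_⟩
  · have := hdiff t
    rw [hχ, hχ, ← sub_smul, ← sub_eq_zero, ← sub_smul] at this
    exact sub_eq_zero.1 ((smul_eq_zero.1 this).resolve_right hv.ne_zero)
  · rw [glOp, ← matUnit_eq i j hij.ne]
    exact hv.raising i j hij

/-- The coefficients of `φ_i`, divided by the product of the numbers `μ_{m,i-1}`. -/
noncomputable def normCoeff (V : Type*) [AddCommGroup V] [Module ℂ V] [LieRingModule (G n) V]
    [LieModule ℂ (G n) V] (μ : Weight n) (i k : Fin (n + 1)) : End ℂ V :=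
  (∏ m ∈ Finset.Ico k i, mu μ m i)⁻¹ • UniversalEnvelopingAlgebra.lift ℂ (repSl n V) (Q μ i k)

theorem lift_Q (μ : Weight n) {i k : Fin (n + 1)} (hk : k < i) :
    UniversalEnvelopingAlgebra.lift ℂ (repSl n V) (Q μ i k) =
      ∑ l ∈ Finset.Ioc k i, (∏ m ∈ Finset.Ioo k l, mu μ m i) •
        (UniversalEnvelopingAlgebra.lift ℂ (repSl n V) (Q μ i l) * glOp n V l k) := by
  rw [Q, if_neg hk.not_ge, map_sum]
  rw [Finset.sum_subtype (F := inferInstance) (p := fun l => k < l ∧ l ≤ i) (Finset.Ioc k i)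
    (fun l => Finset.mem_Ioc)]
  refine Finset.sum_congr rfl fun l _ => ?_
  have h : (Finset.univ.filter fun m => k < m ∧ m < l.1) = Finset.Ioo k l.1 := by ext; simp
  rw [map_mul, F, map_smul, UniversalEnvelopingAlgebra.lift_ι_apply, matUnit_eq, mul_smul_comm, h]
  rfl

/-- In the recursion for Q_k the product over k < m < l completes the normalisation of Q_l to that
of Q_k, except for the factor m = k, which is the shifted difference on the left. -/
theorem isRaisingFamily_normCoeff {χ : Fin (n + 1) → ℂ} {μ : Weight n} (h : IsCompatible χ μ)
    (hχ : IsDominant χ) (i : Fin (n + 1)) :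
    IsRaisingFamily (glOp n V) χ i (normCoeff V μ i) := by
  refine ⟨?_, fun k hk => hχ.shiftedDiff_ne_zero hk, fun k hk => ?_⟩
  · rw [normCoeff, Q]; simp
  · have hne : ∀ m < i, mu μ m i ≠ 0 := fun m hm => by
      rw [h.mu_eq hm.le]; exact hχ.shiftedDiff_ne_zero hm
    rw [← h.mu_eq hk.le, normCoeff, lift_Q μ hk, Finset.smul_sum, Finset.smul_sum]
    refine Finset.sum_congr rfl fun l hl => ?_
    rw [Finset.mem_Ioc] at hl
    have hprod : ∏ m ∈ Finset.Ico k i, mu μ m i =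
        mu μ k i * (∏ m ∈ Finset.Ioo k l, mu μ m i) * ∏ m ∈ Finset.Ico l i, mu μ m i := by
      rw [← Finset.prod_insert (s := Finset.Ioo k l) (a := k) (f := fun m => mu μ m i) (by simp),
        Finset.Ioo_insert_left hl.1, ← Finset.prod_union (Finset.Ico_disjoint_Ico_consecutive _ _ _),
        Finset.Ico_union_Ico_eq_Ico hl.1.le hl.2]
    have h1 := hne k hk
    have h2 : ∏ m ∈ Finset.Ioo k l, mu μ m i ≠ 0 := Finset.prod_ne_zero_iff.2 fun m hm =>
      hne m ((Finset.mem_Ioo.1 hm).2.trans_le hl.2)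
    rw [normCoeff, smul_smul, smul_smul, smul_mul_assoc, hprod]
    congr 1
    field_simp

theorem phi_eq {χ : Fin (n + 1) → ℂ} {μ : Weight n} (h : IsCompatible χ μ)
    (hχ : IsDominant χ) (i : Fin (n + 1)) :
    (phi μ i : End ℂ V) =
      (∏ m ∈ Finset.Iio i, mu μ m i) • raiseOp (pOp n V) (normCoeff V μ i) i := by
  have hne : ∀ m < i, mu μ m i ≠ 0 := fun m hm => by
    rw [h.mu_eq hm.le]; exact hχ.shiftedDiff_ne_zero hm
  have hterm : ∀ k ≤ i, (∏ m ∈ Finset.Iio i, mu μ m i) • (normCoeff V μ i k * pOp n V k) =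
      UniversalEnvelopingAlgebra.lift ℂ (repSl n V) (Q μ i k) * scaledP μ i k := by
    intro k hk
    have hprod : ∏ m ∈ Finset.Iio i, mu μ m i =
        (∏ m ∈ Finset.Iio k, mu μ m i) * ∏ m ∈ Finset.Ico k i, mu μ m i := by
      rw [← Finset.prod_union]
      · congr 1
        ext m
        simp only [Finset.mem_union, Finset.mem_Iio, Finset.mem_Ico, Fin.lt_def, Fin.le_def] at *
        omega
      · rw [Finset.disjoint_left]
        intro m hm hm'
        simp only [Finset.mem_Iio, Finset.mem_Ico] at hm hm'
        exact absurd hm hm'.1.not_gt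
    have h2 : ∏ m ∈ Finset.Ico k i, mu μ m i ≠ 0 := Finset.prod_ne_zero_iff.2 fun m hm =>
      hne m (Finset.mem_Ico.1 hm).2
    have h3 : (Finset.univ.filter fun m => m < k) = Finset.Iio k := by ext; simp
    rw [scaledP, h3, normCoeff, hprod, mul_smul_comm, smul_mul_assoc, smul_smul, mul_assoc,
      mul_inv_cancel₀ h2, mul_one]
    rfl
  have hIic : Finset.Iic i = insert i (Finset.univ.filter fun k => k < i) := by
    ext k; simp [le_iff_eq_or_lt]
  rw [raiseOp, Finset.smul_sum, Finset.sum_congr rfl fun k hk => hterm k (Finset.mem_Iic.1 hk),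
    hIic, Finset.sum_insert (by simp), phi]
  congr 1
  rw [Q, if_pos le_rfl, map_one, one_mul]

theorem exists_phi_apply_eq [FiniteDimensional ℂ V] {χ : Fin (n + 1) → ℂ} {μ : Weight n}
    (h : IsCompatible χ μ) {x : V} (hx : IsHW (glOp n V) χ x) (i : Fin (n + 1)) :
    ∃ c : ℂ, c ≠ 0 ∧ phi μ i x = c • raiseOp (pOp n V) (normCoeff V μ i) i x := by
  by_cases h0 : x = 0
  · exact ⟨1, one_ne_zero, by rw [h0]; simp⟩
  · have hχ := hx.isDominant (isStdAction_rep n V).gl h0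
    refine ⟨_, Finset.prod_ne_zero_iff.2 fun m hm => ?_, by rw [phi_eq h hχ, LinearMap.smul_apply]⟩
    rw [Finset.mem_Iio] at hm
    rw [h.mu_eq hm.le]
    exact hχ.shiftedDiff_ne_zero hm

end Representation

end SlStd

/-! ### Iterates of the φ_i and reordering up to scalars -/

namespace SlStd

open Module

section Iterates

variable {n : ℕ} {V : Type*} [AddCommGroup V] [Module ℂ V]

/-- Equality of weights, and of vectors up to non-zero scalars. -/
def PairEquiv (x y : Weight n × V) : Prop := x.1 = y.1 ∧ ∃ c : ℂ, c ≠ 0 ∧ y.2 = c • x.2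

theorem PairEquiv.refl (x : Weight n × V) : PairEquiv x x := ⟨rfl, 1, one_ne_zero, by simp⟩

theorem PairEquiv.symm {x y : Weight n × V} (h : PairEquiv x y) : PairEquiv y x := by
  obtain ⟨h1, c, hc, h2⟩ := h
  exact ⟨h1.symm, c⁻¹, inv_ne_zero hc, by rw [h2, smul_smul, inv_mul_cancel₀ hc, one_smul]⟩

theorem PairEquiv.trans {x y z : Weight n × V} (h : PairEquiv x y) (h' : PairEquiv y z) :
    PairEquiv x z := by
  obtain ⟨h1, c, hc, h2⟩ := h
  obtain ⟨h3, d, hd, h4⟩ := h'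
  exact ⟨h1.trans h3, d * c, mul_ne_zero hd hc, by rw [h4, h2, smul_smul]⟩

variable [LieRingModule (G n) V] [LieModule ℂ (G n) V]

/-- The second component is zero or a highest weight vector whose weight is the first component. -/
def IsHWPair (x : Weight n × V) : Prop := ∃ χ, IsCompatible χ x.1 ∧ IsHW (glOp n V) χ x.2

theorem PairEquiv.phiStep {x y : Weight n × V} (h : PairEquiv x y) (i : Fin (n + 1)) :
    PairEquiv (phiStep i x) (phiStep i y) := by
  obtain ⟨h1, c, hc, h2⟩ := h
  refine ⟨?_, c, hc, ?_⟩
  · simp only [SlStd.phiStep, h1]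
  · simp only [SlStd.phiStep, h1, h2, map_smul]

theorem PairEquiv.iterate {x y : Weight n × V} (h : PairEquiv x y) (i : Fin (n + 1)) (r : ℕ) :
    PairEquiv ((SlStd.phiStep i)^[r] x) ((SlStd.phiStep i)^[r] y) := by
  induction r with
  | zero => exact h
  | succ r ih => rw [Function.iterate_succ_apply', Function.iterate_succ_apply']; exact ih.phiStep i

/-- The iterate of the steps along a list of indices. -/
def foldSteps (k : Fin (n + 1) → ℕ) (l : List (Fin (n + 1))) (x : Weight n × V) : Weight n × V :=
  l.foldl (fun x i => (phiStep i)^[k i] x) x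

theorem foldSteps_cons (k : Fin (n + 1) → ℕ) (a : Fin (n + 1)) (l : List (Fin (n + 1)))
    (x : Weight n × V) : foldSteps k (a :: l) x = foldSteps k l ((phiStep a)^[k a] x) := rfl

theorem PairEquiv.foldSteps {x y : Weight n × V} (h : PairEquiv x y) (k : Fin (n + 1) → ℕ)
    (l : List (Fin (n + 1))) : PairEquiv (foldSteps k l x) (foldSteps k l y) := by
  induction l generalizing x y with
  | nil => exact h
  | cons a l ih => exact ih (h.iterate a (k a))

theorem iterate_phiStep_fst (i : Fin (n + 1)) (r : ℕ) (x : Weight n × V) :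
    ((phiStep i)^[r] x).1 = x.1 + r • (fundWeight n ((i : ℕ) + 1) - fundWeight n (i : ℕ)) := by
  induction r with
  | zero => simp
  | succ r ih =>
    rw [Function.iterate_succ_apply', phiStep, ih, succ_nsmul, add_sub_assoc, add_assoc]

theorem foldSteps_fst (k : Fin (n + 1) → ℕ) (l : List (Fin (n + 1))) (x : Weight n × V) :
    (foldSteps k l x).1 = x.1 +
      (l.map fun i => k i • (fundWeight n ((i : ℕ) + 1) - fundWeight n (i : ℕ))).sum := by
  induction l generalizing x with
  | nil => simp [foldSteps]
  | cons a l ih =>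
    rw [foldSteps_cons, ih, iterate_phiStep_fst, List.map_cons, List.sum_cons, add_assoc]

/-- The weight thus sees only differences of consecutive exponents, so it determines the exponent
vector up to constant vectors. -/
theorem foldSteps_finRange_fst (k : Fin (n + 1) → ℕ) (x : Weight n × V) (t : Fin n) :
    (foldSteps k (List.finRange (n + 1)) x).1 t = x.1 t + (k t.castSucc - k t.succ) := by
  rw [foldSteps_fst, ← Fin.sum_univ_def, Pi.add_apply, Finset.sum_apply]
  congr 1
  have h : ∀ i : Fin (n + 1),
      (k i • (fundWeight n ((i : ℕ) + 1) - fundWeight n (i : ℕ))) t =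
        (if i = t.castSucc then (k i : ℂ) else 0) - (if i = t.succ then (k i : ℂ) else 0) := by
    intro i
    simp only [Pi.smul_apply, Pi.sub_apply, fundWeight, nsmul_eq_mul, Fin.ext_iff,
      Fin.val_castSucc, Fin.val_succ, add_left_inj, eq_comm (a := (i : ℕ)), mul_sub, mul_ite,
      mul_one, mul_zero]
  rw [Finset.sum_congr rfl fun i _ => h i]
  simp

theorem foldSteps_congr {k k' : Fin (n + 1) → ℕ} {l : List (Fin (n + 1))}
    (h : ∀ i ∈ l, k i = k' i) (x : Weight n × V) : foldSteps k l x = foldSteps k' l x := by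
  induction l generalizing x with
  | nil => rfl
  | cons a l ih =>
    rw [foldSteps_cons, foldSteps_cons, h a (by simp), ih fun i hi => h i (by simp [hi])]

variable [FiniteDimensional ℂ V]

theorem IsHWPair.phiStep {x : Weight n × V} (h : IsHWPair x) (i : Fin (n + 1)) :
    IsHWPair (phiStep i x) := by
  obtain ⟨χ, h1, h2⟩ := h
  refine ⟨addWeight ((n : ℂ) + 1)⁻¹ χ i, h1.addWeight _ i, ?_⟩
  by_cases h0 : x.2 = 0
  · simp only [SlStd.phiStep, h0, map_zero]
    exact isHW_zero _
  · obtain ⟨c, _, hc⟩ := exists_phi_apply_eq h1 h2 i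
    simp only [SlStd.phiStep, hc]
    exact ((isStdAction_rep n V).isHW_raiseOp h2 (isRaisingFamily_normCoeff h1
      (h2.isDominant (isStdAction_rep n V).gl h0) i)).smul c

theorem IsHWPair.iterate {x : Weight n × V} (h : IsHWPair x) (i : Fin (n + 1)) (r : ℕ) :
    IsHWPair ((SlStd.phiStep i)^[r] x) := by
  induction r with
  | zero => exact h
  | succ r ih => rw [Function.iterate_succ_apply']; exact ih.phiStep i

theorem IsHWPair.foldSteps {x : Weight n × V} (h : IsHWPair x) (k : Fin (n + 1) → ℕ)
    (l : List (Fin (n + 1))) : IsHWPair (foldSteps k l x) := by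
  induction l generalizing x with
  | nil => exact h
  | cons a l ih => exact ih (h.iterate a (k a))

theorem IsHWPair.phiStep_comm_of_lt {x : Weight n × V} (h : IsHWPair x) {i j : Fin (n + 1)}
    (hij : i < j) : PairEquiv (SlStd.phiStep j (SlStd.phiStep i x))
      (SlStd.phiStep i (SlStd.phiStep j x)) := by
  refine ⟨by simp only [SlStd.phiStep]; abel, ?_⟩
  have hi := h.phiStep i
  have hj := h.phiStep j
  obtain ⟨χ, h1, h2⟩ := h
  by_cases h0 : x.2 = 0
  · exact ⟨1, one_ne_zero, by simp [SlStd.phiStep, h0]⟩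
  have hχ := h2.isDominant (isStdAction_rep n V).gl h0
  have hqi := isRaisingFamily_normCoeff (V := V) h1 hχ i
  have hqj := isRaisingFamily_normCoeff (V := V) h1 hχ j
  have hp := isStdAction_rep n V
  have hi' := hp.isHW_raiseOp h2 hqi
  have hj' := hp.isHW_raiseOp h2 hqj
  have hci := h1.addWeight ((n : ℂ) + 1)⁻¹ i
  have hcj := h1.addWeight ((n : ℂ) + 1)⁻¹ j
  obtain ⟨c, hc, hcomm⟩ := hp.exists_raiseOp_comm h2 hχ hij hqi hqj
    (fun h => isRaisingFamily_normCoeff hcj (hj'.isDominant hp.gl h) i)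
    (fun h => isRaisingFamily_normCoeff hci (hi'.isDominant hp.gl h) j)
  obtain ⟨a, ha, hae⟩ := exists_phi_apply_eq h1 h2 i
  obtain ⟨b, hb, hbe⟩ := exists_phi_apply_eq h1 h2 j
  obtain ⟨a', ha', hae'⟩ := exists_phi_apply_eq hcj hj' i
  obtain ⟨b', hb', hbe'⟩ := exists_phi_apply_eq hci hi' j
  refine ⟨(b * a' * c) / (a * b'), by simp [*], ?_⟩
  simp only [SlStd.phiStep, hae, hbe, map_smul, hae', hbe', hcomm, smul_smul]
  congr 1
  field_simp

theorem IsHWPair.phiStep_comm {x : Weight n × V} (h : IsHWPair x) (i j : Fin (n + 1)) :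
    PairEquiv (SlStd.phiStep j (SlStd.phiStep i x)) (SlStd.phiStep i (SlStd.phiStep j x)) := by
  rcases lt_trichotomy i j with hij | rfl | hij
  · exact h.phiStep_comm_of_lt hij
  · exact PairEquiv.refl _
  · exact (h.phiStep_comm_of_lt hij).symm

theorem IsHWPair.iterate_phiStep_comm {x : Weight n × V} (h : IsHWPair x) (i j : Fin (n + 1))
    (r : ℕ) : PairEquiv ((SlStd.phiStep i)^[r] (SlStd.phiStep j x))
      (SlStd.phiStep j ((SlStd.phiStep i)^[r] x)) := by
  induction r with
  | zero => exact PairEquiv.refl _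
  | succ r ih =>
    rw [Function.iterate_succ_apply', Function.iterate_succ_apply']
    exact (ih.phiStep i).trans ((h.iterate i r).phiStep_comm j i)

theorem IsHWPair.foldSteps_phiStep {x : Weight n × V} (h : IsHWPair x) (k : Fin (n + 1) → ℕ)
    (l : List (Fin (n + 1))) (b : Fin (n + 1)) :
    PairEquiv (SlStd.foldSteps k l (SlStd.phiStep b x))
      (SlStd.phiStep b (SlStd.foldSteps k l x)) := by
  induction l generalizing x with
  | nil => exact PairEquiv.refl _
  | cons a l ih =>
    exact ((h.iterate_phiStep_comm a b (k a)).foldSteps k l).trans (ih (h.iterate a (k a)))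

/-- The extra φ_b is moved past all later steps, each exchange costing a nonzero scalar. Absence of
repetitions ensures that the exponent of b is used only once. -/
theorem IsHWPair.foldSteps_add_single {x : Weight n × V} (h : IsHWPair x) (k : Fin (n + 1) → ℕ)
    {l : List (Fin (n + 1))} (hl : l.Nodup) {b : Fin (n + 1)} (hb : b ∈ l) :
    PairEquiv (SlStd.foldSteps (k + Pi.single b 1) l x)
      (SlStd.phiStep b (SlStd.foldSteps k l x)) := by
  induction l generalizing x with
  | nil => simp at hb
  | cons a l ih =>
    rw [foldSteps_cons, foldSteps_cons]
    rw [List.nodup_cons] at hl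
    by_cases hab : a = b
    · subst hab
      have h1 : (k + Pi.single a 1 : Fin (n + 1) → ℕ) a = k a + 1 := by simp
      rw [h1, Function.iterate_succ_apply', foldSteps_congr (k' := k)]
      · exact (h.iterate a (k a)).foldSteps_phiStep k l a
      · intro i hi
        have : i ≠ a := fun hia => hl.1 (hia ▸ hi)
        simp [this]
    · have h1 : (k + Pi.single b 1 : Fin (n + 1) → ℕ) a = k a := by simp [hab]
      rw [h1]
      exact ih (h.iterate a (k a)) hl.2 ((List.mem_cons.1 hb).resolve_left (Ne.symm hab))

end Iterates

/-! ### Spanning and independence of the summands -/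

section Decomposition

variable {n : ℕ} {V : Type*} [AddCommGroup V] [Module ℂ V] [LieRingModule (G n) V]
  [LieModule ℂ (G n) V]

theorem phi_apply_mem {W : Submodule ℂ V} (hW : IsInvariant (glOp n V) W) {x : V}
    (hx : ∀ a, pOp n V a x ∈ W) (μ : Weight n) (i : Fin (n + 1)) : phi μ i x ∈ W := by
  have h : ∀ k, scaledP μ i k x ∈ W := fun k => W.smul_mem _ (hx k)
  rw [phi, LinearMap.add_apply, LinearMap.sum_apply]
  exact W.add_mem (h i) (W.sum_mem fun k _ => lift_apply_mem (repSl_mem hW) _ _ (h k))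

variable [FiniteDimensional ℂ V]

/-- The vectors `P_a x` lie in the module generated by the vectors `φ_i(x)`. -/
theorem pOp_mem_of_phi_mem {χ : Fin (n + 1) → ℂ} {μ : Weight n} (h : IsCompatible χ μ) {x : V}
    (hx : IsHW (glOp n V) χ x) {W : Submodule ℂ V} (hW : IsInvariant (glOp n V) W)
    (hφ : ∀ i, phi μ i x ∈ W) (a : Fin (n + 1)) : pOp n V a x ∈ W := by
  by_cases h0 : x = 0
  · rw [h0, map_zero]; exact zero_mem _
  have hχ := hx.isDominant (isStdAction_rep n V).gl h0
  -- φ_a(x) is p_a x plus terms q_k p_k x with k < a, up to a nonzero scalar, so the system is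
  -- solved upwards in a.
  induction a using WellFoundedLT.induction with
  | ind a ih =>
    have hq := isRaisingFamily_normCoeff (V := V) h hχ a
    obtain ⟨c, hc, hce⟩ := exists_phi_apply_eq h hx a
    have h1 := hφ a
    rw [hce, Submodule.smul_mem_iff _ hc, raiseOp, LinearMap.sum_apply,
      ← Finset.add_sum_erase _ _ (Finset.mem_Iic.2 le_rfl), hq.top, one_mul] at h1
    refine (Submodule.add_mem_iff_left _ (Submodule.sum_mem _ fun k hk => ?_)).1 h1
    rw [Finset.mem_erase, Finset.mem_Iic] at hk
    exact hq.apply_mem hW k hk.2 _ (ih k (lt_of_le_of_ne hk.2 hk.1))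

theorem phiIterate_add_single {μ : Weight n} {v : V} (h : IsHWPair (μ, v)) (k : Fin (n + 1) → ℕ)
    (b : Fin (n + 1)) : ∃ c : ℂ, c ≠ 0 ∧
      phi (foldSteps k (List.finRange (n + 1)) (μ, v)).1 b (phiIterate k μ v) =
        c • phiIterate (k + Pi.single b 1) μ v :=
  (h.foldSteps_add_single k (List.nodup_finRange _) (List.mem_finRange b)).2

/-- The sum is stable under sl(n+1) and contains v, so stability under the P_a is enough. It is
checked on the iterates, where φ_b just moves to another iterate, and spreads to the sum because the
P_a span an sl-stable space. -/
theorem iSup_generated_eq_top {μ : Weight n} {v : V} (h : IsHWPair (μ, v))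
    (hcyc : generated (rep n V) v = ⊤) :
    ⨆ k : Fin (n + 1) → ℕ, generated (repSl n V) (phiIterate k μ v) = ⊤ := by
  simp only [generated_repSl]
  set Y := ⨆ k : Fin (n + 1) → ℕ, invClosure (glOp n V) {phiIterate k μ v} with hY
  have hp := isStdAction_rep n V
  have hmem : ∀ k, phiIterate k μ v ∈ Y := fun k =>
    Submodule.mem_iSup_of_mem k (subset_invClosure _ rfl)
  have hinv : IsInvariant (glOp n V) Y := by
    intro i j
    suffices H : Y ≤ Y.comap (glOp n V i j) from fun x hx => H hx
    exact iSup_le fun k x hx => Submodule.mem_iSup_of_mem k (isInvariant_invClosure _ i j x hx)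
  have hpk : ∀ a k, pOp n V a (phiIterate k μ v) ∈ Y := by
    intro a k
    obtain ⟨χ, h1, h2⟩ := h.foldSteps k (List.finRange (n + 1))
    refine pOp_mem_of_phi_mem h1 h2 hinv (fun b => ?_) a
    obtain ⟨c, _, hc⟩ := phiIterate_add_single h k b
    exact hc ▸ Y.smul_mem c (hmem _)
  have hpY : ∀ a, ∀ x ∈ Y, pOp n V a x ∈ Y := by
    let Z : Submodule ℂ V := Y ⊓ ⨅ a, Y.comap (pOp n V a)
    have hZ : ∀ x, x ∈ Z ↔ x ∈ Y ∧ ∀ a, pOp n V a x ∈ Y := fun x => by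
      simp [Z, Submodule.mem_iInf]
    have hZinv : IsInvariant (glOp n V) Z := by
      intro i j x hx
      rw [hZ] at hx ⊢
      refine ⟨hinv i j x hx.1, fun a => ?_⟩
      have h1 := hp.apply_p i j a x
      rw [add_sub_assoc, ← sub_eq_iff_eq_add] at h1
      rw [← h1]
      refine Y.sub_mem (hinv i j _ (hx.2 a)) (Y.sub_mem ?_ ?_)
      · split_ifs
        · exact hx.2 i
        · exact zero_mem _
      · split_ifs
        · exact Y.smul_mem _ (hx.2 a)
        · exact zero_mem _
    have hle : Y ≤ Z := iSup_le fun k => invClosure_le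
      (by rw [Set.singleton_subset_iff, SetLike.mem_coe, hZ]; exact ⟨hmem k, fun a => hpk a k⟩) hZinv
    exact fun a x hx => ((hZ x).1 (hle hx)).2 a
  have h0 : phiIterate (0 : Fin (n + 1) → ℕ) μ v = v := by
    have : foldSteps (0 : Fin (n + 1) → ℕ) (List.finRange (n + 1)) (μ, v) = (μ, v) := by
      generalize List.finRange (n + 1) = l
      induction l with
      | nil => rfl
      | cons a l ih => exact ih
    exact congrArg Prod.snd this
  rw [eq_top_iff, ← hcyc]
  exact generated_le (h0 ▸ hmem 0) (rep_mem hinv hpY)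

/-- The iterate for larger exponents lies in the image of the ideal spanned by the `P_a`. -/
theorem phiIterate_add_mem {μ : Weight n} {v : V} (h : IsHWPair (μ, v)) (k : Fin (n + 1) → ℕ)
    {M PM : Submodule ℂ V} (hM : phiIterate k μ v ∈ M) (hPM : PM ≤ M)
    (hinv : IsInvariant (glOp n V) PM) (hp : ∀ a, ∀ x ∈ M, pOp n V a x ∈ PM) :
    ∀ m : Fin (n + 1) → ℕ, m ≠ 0 → phiIterate (k + m) μ v ∈ PM := by
  suffices H : ∀ d : ℕ, ∀ m : Fin (n + 1) → ℕ, ∑ i, m i = d + 1 → phiIterate (k + m) μ v ∈ PM by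
    intro m hm
    obtain ⟨b, hb⟩ := Function.ne_iff.1 hm
    refine H (∑ i, m i - 1) m (Nat.sub_add_cancel ?_).symm
    exact (Nat.one_le_iff_ne_zero.2 hb).trans
      (Finset.single_le_sum (f := m) (fun _ _ => Nat.zero_le _) (Finset.mem_univ b))
  intro d
  have hstep : ∀ m : Fin (n + 1) → ℕ, phiIterate (k + m) μ v ∈ M →
      ∀ b, phiIterate (k + m + Pi.single b 1) μ v ∈ PM := by
    intro m hm b
    obtain ⟨c, hc, hce⟩ := phiIterate_add_single h (k + m) b
    rw [← Submodule.smul_mem_iff _ hc, ← hce]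
    exact phi_apply_mem hinv (fun a => hp a _ hm) _ _
  have hpred : ∀ (d : ℕ) (m : Fin (n + 1) → ℕ), ∑ i, m i = d + 1 →
      ∃ (b : Fin (n + 1)) (m' : Fin (n + 1) → ℕ), m = m' + Pi.single b 1 ∧ ∑ i, m' i = d := by
    intro d m hm
    obtain ⟨b, _, hb⟩ := Finset.exists_ne_zero_of_sum_ne_zero (hm.trans_ne (Nat.succ_ne_zero d))
    have hmb : m = m - Pi.single b 1 + Pi.single b 1 := by
      funext i
      by_cases hi : i = b
      · subst hi
        simp only [Pi.add_apply, Pi.sub_apply, Pi.single_eq_same]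
        omega
      · simp [hi]
    refine ⟨b, _, hmb, ?_⟩
    rw [hmb] at hm
    simp only [Pi.add_apply, Finset.sum_add_distrib, Finset.sum_pi_single'] at hm
    simpa using hm
  induction d with
  | zero =>
    intro m hm
    obtain ⟨b, m', rfl, hm'⟩ := hpred 0 m hm
    have h0 : m' = 0 := funext fun i => Finset.sum_eq_zero_iff.1 hm' i (Finset.mem_univ i)
    rw [← add_assoc]
    exact hstep m' (by rw [h0, add_zero]; exact hM) b
  | succ d ih =>
    intro m hm
    obtain ⟨b, m', rfl, hm'⟩ := hpred (d + 1) m hm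
    rw [← add_assoc]
    exact hstep m' (hPM (ih m' hm')) b

theorem iSupIndep_generated (hn : 1 ≤ n) {μ : Weight n} {v : V} (h : IsHWPair (μ, v)) :
    iSupIndep fun k : Fin (n + 1) → ℕ => generated (repSl n V) (phiIterate k μ v) := by
  classical
  have hp := isStdAction_rep n V
  simp only [generated_repSl]
  rw [iSupIndep_iff_finsetSum_eq_zero_imp_eq_zero]
  intro s u hu hsum
  by_contra! hne
  choose χ hcompat hχ using fun k => h.foldSteps k (List.finRange (n + 1))
  obtain ⟨c, ν, hc, hex, hν⟩ := hp.gl.exists_relation hχ s u hu hsum hne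
  change ∑ k ∈ s, c k • phiIterate k μ v = 0 at hc
  change ∃ k ∈ s, c k • phiIterate k μ v ≠ 0 at hex
  change ∀ k ∈ s, c k • phiIterate k μ v ≠ 0 → χ k = ν at hν
  -- The exponents in the relation differ by constant vectors, so comparing one entry compares them
  -- completely.
  obtain ⟨k₀, hk₀, hmin⟩ := Finset.exists_min_image
    (s.filter fun k => c k • phiIterate k μ v ≠ 0) (fun k => k 0)
    (by obtain ⟨k, hk, hk0⟩ := hex; exact ⟨k, Finset.mem_filter.2 ⟨hk, hk0⟩⟩)
  rw [Finset.mem_filter] at hk₀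
  have hcmp : ∀ k ∈ s, c k • phiIterate k μ v ≠ 0 → ∃ r : ℕ, k = k₀ + fun _ => r := by
    intro k hk hk0
    have hle : k₀ 0 ≤ k 0 := hmin k (Finset.mem_filter.2 ⟨hk, hk0⟩)
    refine ⟨k 0 - k₀ 0, funext fun i => ?_⟩
    have hχk : χ k = χ k₀ := (hν k hk hk0).trans (hν k₀ hk₀.1 hk₀.2).symm
    have hstep : ∀ t : Fin n, k t.castSucc + k₀ t.succ = k₀ t.castSucc + k t.succ := by
      intro t
      have h1 := hcompat k t
      have h2 := hcompat k₀ t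
      rw [foldSteps_finRange_fst] at h1 h2
      rw [hχk] at h1
      have h3 : (k t.castSucc : ℂ) + k₀ t.succ = k₀ t.castSucc + k t.succ := by
        linear_combination h2 - h1
      exact_mod_cast h3
    have hconst : ∀ i, k i + k₀ 0 = k₀ i + k 0 := by
      intro i
      induction i using Fin.induction with
      | zero => exact add_comm _ _
      | succ t ih => have := hstep t; omega
    have := hconst i
    simp only [Pi.add_apply]
    omega
  let M := generated (rep n V) (phiIterate k₀ μ v)
  have hMinv : IsInvariant (glOp n V) M := fun i j x hx => apply_mem_generated _ hx
  have hMp : ∀ a, ∀ x ∈ M, pOp n V a x ∈ M := fun a x hx => apply_mem_generated _ hx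
  let PM : Submodule ℂ V := ⨆ a, M.map (pOp n V a)
  have hpPM : ∀ a, ∀ x ∈ M, pOp n V a x ∈ PM := fun a x hx =>
    Submodule.mem_iSup_of_mem a ⟨x, hx, rfl⟩
  have hPMM : PM ≤ M := iSup_le fun a => by
    rintro _ ⟨x, hx, rfl⟩
    exact hMp a x hx
  have hPMinv : IsInvariant (glOp n V) PM := by
    intro i j
    suffices H : PM ≤ PM.comap (glOp n V i j) from fun x hx => H hx
    refine iSup_le fun a => ?_
    rintro _ ⟨x, hx, rfl⟩
    rw [Submodule.mem_comap, hp.apply_p]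
    refine PM.sub_mem (PM.add_mem (hpPM a _ (hMinv i j x hx)) ?_) ?_
    · split_ifs
      · exact hpPM i x hx
      · exact zero_mem _
    · split_ifs
      · exact PM.smul_mem _ (hpPM a x hx)
      · exact zero_mem _
  have hk₀M : phiIterate k₀ μ v ∈ M := mem_generated_self _
  -- The relation is solved for the least iterate; all other nonzero terms have exponent k₀ + (r, …,
  -- r) with r > 0 and lie in PM.
  have hk₀PM : phiIterate k₀ μ v ∈ PM := by
    rw [← Finset.add_sum_erase _ _ hk₀.1] at hc
    have hc0 : c k₀ ≠ 0 := fun h => hk₀.2 (by rw [h, zero_smul])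
    rw [← Submodule.smul_mem_iff _ hc0, eq_neg_of_add_eq_zero_left hc]
    refine PM.neg_mem (PM.sum_mem fun k hk => ?_)
    rw [Finset.mem_erase] at hk
    by_cases hk0 : c k • phiIterate k μ v = 0
    · rw [hk0]; exact zero_mem _
    · obtain ⟨r, rfl⟩ := hcmp k hk.2 hk0
      refine PM.smul_mem _ (phiIterate_add_mem h k₀ hk₀M hPMM hPMinv hpPM _ fun hr => hk.1 ?_)
      rw [hr, add_zero]
  -- This is where n ≥ 1 enters: for n = 0 the algebra sl(1) is zero and nothing forces P_1 to be
  -- nilpotent.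
  have hκ : ((n : ℂ) + 1)⁻¹ ≠ 1 := by
    rw [Ne, inv_eq_one, add_eq_right, Nat.cast_eq_zero]
    omega
  have hbot : M = ⊥ := hp.eq_bot_of_le_iSup_map hκ hMp
    (generated_le hk₀PM (rep_mem hPMinv fun a x hx => hpPM a x (hPMM hx)))
  rw [hbot, Submodule.mem_bot] at hk₀M
  exact hk₀.2 (by rw [hk₀M, smul_zero])

end Decomposition

end SlStd

theorem proposition3 (n : ℕ) (hn : 1 ≤ n) (V : Type*) [AddCommGroup V] [Module ℂ V]
    [LieRingModule (SlStd.G n) V] [LieModule ℂ (SlStd.G n) V] [FiniteDimensional ℂ V]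
    (μ₀ : SlStd.Weight n) (v : V) (hv : SlStd.IsHighestWeightVector μ₀ v)
    (hcyc : SlStd.generated (SlStd.rep n V) v = ⊤) :
    DirectSum.IsInternal (fun k : Fin (n + 1) → ℕ =>
      SlStd.generated (SlStd.repSl n V) (SlStd.phiIterate k μ₀ v)) := by
  have h : SlStd.IsHWPair (μ₀, v) := hv.exists_isHW
  rw [DirectSum.isInternal_submodule_iff_iSupIndep_and_iSup_eq_top]
  exact ⟨SlStd.iSupIndep_generated hn h, SlStd.iSup_generated_eq_top h hcyc⟩
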